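/- Let $\mathbb K=\mathbb R$ or $\mathbb C$ and let $\mathcal A$ be a $3$-dimensional $\mathbb K$-vector space with two Lie brackets $[\cdot,\cdot]$ and $[\cdot,\cdot]_1$. Assume that $[\cdot,\cdot]$ is not unimodular (i.e. $\operatorname{tr}[a,\cdot]\neq 0$ for some $a$), that $[\cdot,\cdot]_1$ is unimodular and non-zero, and that the unimodular ideal $I=\{a\in\mathcal A : \operatorname{tr}[a,\cdot]=0\}$ of $[\cdot,\cdot]$ is an abelian ideal for $[\cdot,\cdot]_1$. Let $\Lambda,\Lambda_1$ be the Lie–Poisson structures on $\mathcal A^*$ of $[\cdot,\cdot]$ and $[\cdot,\cdot]_1$, that is $\Lambda(a,b)=[a,b]$ and $\Lambda_1(a,b)=[a,b]_1$ for $a,b\in\mathcal A$ regarded as linear functions on $\mathcal A^*$. The pair $(\Lambda,\Lambda_1)$ is called generic at $p\in\mathcal A^*$ if $(s\Lambda+t\Lambda_1)(p)\neq 0$ for all $(s,t)\in\mathbb C^2\setminus\{0\}$ (after complexification if $\mathbb K=\mathbb R$), and flat at $p$ if in some coordinates around $p$ (smooth if $\mathbb K=\mathbb R$, holomorphic if $\mathbb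 K=\mathbb C$) both $\Lambda$ and $\Lambda_1$ have constant coefficients. The pair is generic if it is generic at some point, and flat if it is flat at every point where it is generic. Then for every $u\in\mathcal A\setminus I$ the following are equivalent: (i) $(\Lambda,\Lambda_1)$ is generic and not flat; (ii) some eigenvector of $[u,\cdot]_1|_I$ is not an eigenvector of $[u,\cdot]|_I$, where, if $\mathbb K=\mathbb R$, eigenvectors are taken in the complexification $I\otimes_{\mathbb R}\mathbb C$ and eigenvalues may be complex. -/

import Mathlib

open scoped ContDiff TensorProduct

/-- A Lie bracket on the `𝕜`-module `A`, as a bundled bilinear map (two different brackets are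
considered on the same space, so the type class `LieRing` is not used). -/
structure LieBracket (𝕜 A : Type*) [CommRing 𝕜] [AddCommGroup A] [Module 𝕜 A] where
  /-- the bilinear map `(x, y) ↦ [x, y]`; in particular `ad x = [x, ·]` is a linear endomorphism -/
  ad : A →ₗ[𝕜] A →ₗ[𝕜] A
  self_eq_zero : ∀ x, ad x x = 0
  jacobi : ∀ x y z, ad x (ad y z) + ad y (ad z x) + ad z (ad x y) = 0

namespace LieBracket

section Algebra

variable {𝕜 A : Type*} [CommRing 𝕜] [AddCommGroup A] [Module 𝕜 A]

/-- `tr [a, ·] = 0` for all `a`. -/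
def IsUnimodular (L : LieBracket 𝕜 A) : Prop :=
  ∀ a, LinearMap.trace 𝕜 A (L.ad a) = 0

/-- The set `{a | tr [a, ·] = 0}`. -/
noncomputable def unimodularIdeal (L : LieBracket 𝕜 A) : Submodule 𝕜 A :=
  LinearMap.ker (LinearMap.trace 𝕜 A ∘ₗ L.ad)

/-- `J` is an ideal for the bracket `L`. -/
def IsIdeal (L : LieBracket 𝕜 A) (J : Submodule 𝕜 A) : Prop :=
  ∀ a, ∀ x ∈ J, L.ad a x ∈ J

/-- The bracket `L` vanishes on `J`. -/
def IsAbelianOn (L : LieBracket 𝕜 A) (J : Submodule 𝕜 A) : Prop :=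
  ∀ x ∈ J, ∀ y ∈ J, L.ad x y = 0

/-- The restriction of `[u, ·]` to an ideal `J`. -/
def adRestrict (L : LieBracket 𝕜 A) {J : Submodule 𝕜 A} (hJ : L.IsIdeal J) (u : A) :
    Module.End 𝕜 J :=
  (L.ad u).restrict (hJ u)

theorem skew (L : LieBracket 𝕜 A) (x y : A) : L.ad x y = -L.ad y x := by
  have h := L.self_eq_zero (x + y)
  simp only [map_add, LinearMap.add_apply, L.self_eq_zero, zero_add, add_zero] at h
  exact eq_neg_of_add_eq_zero_right h

theorem isIdeal_unimodularIdeal (L : LieBracket 𝕜 A) : L.IsIdeal L.unimodularIdeal := by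
  intro a x _
  have h : L.ad (L.ad a x) = L.ad a * L.ad x - L.ad x * L.ad a := by
    ext z
    have h1 := L.jacobi a x z
    rw [L.skew z (L.ad a x), L.skew z a, map_neg] at h1
    simp only [LinearMap.sub_apply, Module.End.mul_apply]
    rw [sub_eq_add_neg]
    exact (sub_eq_zero.mp (by rw [sub_eq_add_neg]; exact h1)).symm
  simp only [unimodularIdeal, LinearMap.mem_ker, LinearMap.comp_apply, h, map_sub]
  rw [LinearMap.trace_mul_comm, sub_self]

end Algebra

end LieBracket

/-- A bi-vector on a finite-dimensional space `E`, i.e. an element of `Λ²E`, viewed as an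
alternating bilinear form on the dual space of `E`. -/
abbrev Bivector (𝕜 E : Type*) [RCLike 𝕜] [NormedAddCommGroup E] [NormedSpace 𝕜 E] :=
  {B : LinearMap.BilinForm 𝕜 (StrongDual 𝕜 E) // B.IsAlt}

section LiePoisson

variable {𝕜 A : Type*} [RCLike 𝕜] [NormedAddCommGroup A] [NormedSpace 𝕜 A]
  [FiniteDimensional 𝕜 A]

/-- The canonical identification of `A**` with `A` (for `A` of finite dimension): it sends the
covector `ξ` on `A*` to the `a : A` with `ξ p = p a` for all `p : A*`. -/
noncomputable def ofBidual :
    StrongDual 𝕜 (StrongDual 𝕜 A) →ₗ[𝕜] A where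
  toFun ξ := (Module.evalEquiv 𝕜 A).symm
    (ξ.toLinearMap ∘ₗ (LinearMap.toContinuousLinearMap (𝕜 := 𝕜) (E := A) (F' := 𝕜)).toLinearMap)
  map_add' ξ η := by
    rw [← map_add]; rfl
  map_smul' c ξ := by
    rw [RingHom.id_apply, ← map_smul]; rfl

theorem apply_ofBidual (p : StrongDual 𝕜 A) (ξ : StrongDual 𝕜 (StrongDual 𝕜 A)) :
    p (ofBidual ξ) = ξ p := by
  have h := Module.apply_evalEquiv_symm_apply (R := 𝕜) (M := A) p.toLinearMap
    (ξ.toLinearMap ∘ₗ (LinearMap.toContinuousLinearMap (𝕜 := 𝕜) (E := A) (F' := 𝕜)).toLinearMap)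
  exact h

/-- The Lie-Poisson structure of the bracket `L` on `A*`: the elements of `A` are the linear
functions on `A*`, and `Λ(a, b)` is the function `[a, b]`, so that `Λ(a, b)(p) = p [a, b]`. -/
noncomputable def liePoisson (L : LieBracket 𝕜 A) (p : StrongDual 𝕜 A) :
    Bivector 𝕜 (StrongDual 𝕜 A) :=
  ⟨(L.ad.compl₁₂ ofBidual ofBidual).compr₂ p.toLinearMap, fun ξ => by
    simp [L.self_eq_zero]⟩

end LiePoisson

section Pairs

variable {𝕜 E : Type*} [RCLike 𝕜] [NormedAddCommGroup E] [NormedSpace 𝕜 E]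

/-- Genericity at `p` of a pair of bi-vector fields on a space `E` of dimension `3 = 2n - 1`,
`n = 2`: the power `(a Λ + b Λ₁)^(n - 1)`, which is `a Λ + b Λ₁` itself, does not vanish at `p`
for any `(a, b) ∈ ℂ² \ {0}`. -/
def IsGenericAt [Algebra 𝕜 ℂ] (Λ Λ₁ : E → Bivector 𝕜 E) (p : E) : Prop :=
  ∀ a b : ℂ, (a, b) ≠ 0 → ∃ ξ η : StrongDual 𝕜 E,
    a * algebraMap 𝕜 ℂ ((Λ p).1 ξ η) + b * algebraMap 𝕜 ℂ ((Λ₁ p).1 ξ η) ≠ 0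

/-- The `i`-th coordinate differential `dxᵢ` at `q` of a coordinate system `φ = (x₁, x₂, x₃)`. -/
noncomputable def coordDiff (φ : E → Fin 3 → 𝕜) (i : Fin 3) (q : E) : StrongDual 𝕜 E :=
  fderiv 𝕜 (fun y => φ y i) q

/-- The bi-vector field `Λ` has constant coefficients `Λ(dxᵢ, dxⱼ)` on `U` in the
coordinates `φ`. -/
def HasConstantCoeffs (Λ : E → Bivector 𝕜 E) (φ : E → Fin 3 → 𝕜) (U : Set E) : Prop :=
  ∀ i j, ∃ c : 𝕜, ∀ q ∈ U, (Λ q).1 (coordDiff φ i q) (coordDiff φ j q) = c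

/-- Flatness at `p` of a pair of bi-vector fields on a space `E` of dimension `3`: in some
coordinates around `p` (smooth if `𝕜 = ℝ`, holomorphic if `𝕜 = ℂ`), both have constant
coefficients. -/
def IsFlatAt (Λ Λ₁ : E → Bivector 𝕜 E) (p : E) : Prop :=
  ∃ φ : OpenPartialHomeomorph E (Fin 3 → 𝕜), p ∈ φ.source ∧
    ContDiffOn 𝕜 ∞ φ φ.source ∧ ContDiffOn 𝕜 ∞ φ.symm φ.target ∧
    HasConstantCoeffs Λ φ φ.source ∧ HasConstantCoeffs Λ₁ φ φ.source

/-- A pair on a dual space is generic if it is generic at some point. -/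
def IsGenericPair [Algebra 𝕜 ℂ] (Λ Λ₁ : E → Bivector 𝕜 E) : Prop :=
  ∃ p, IsGenericAt Λ Λ₁ p

/-- A pair on a dual space is flat if it is flat at every generic point. -/
def IsFlatPair [Algebra 𝕜 ℂ] (Λ Λ₁ : E → Bivector 𝕜 E) : Prop :=
  ∀ p, IsGenericAt Λ Λ₁ p → IsFlatAt Λ Λ₁ p

end Pairs

/-- `v`, a vector of the complexification of `J`, is an eigenvector of (the complexification of)
the endomorphism `f` of `J`, with some complex eigenvalue. For `𝕜 = ℂ` this is the usual notion
of eigenvector. -/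
def IsComplexEigenvector {𝕜 J : Type*} [Field 𝕜] [Algebra 𝕜 ℂ] [AddCommGroup J] [Module 𝕜 J]
    (f : Module.End 𝕜 J) (v : ℂ ⊗[𝕜] J) : Prop :=
  ∃ μ : ℂ, Module.End.HasEigenvector (f.baseChange ℂ) μ v

/-! Take a basis b₀ = u, b₁, b₂ with b₁, b₂ spanning I. Both brackets vanish on I, so in the
coordinates xᵢ = bᵢ on the dual space Λ = ∂₀ ∧ X and Λ₁ = ∂₀ ∧ Y. Here X and Y are linear fields in
the (x₁, x₂)-plane, given by the transposes of f = [u, ·] and g = [u, ·]₁ on I. Thus div X = tr f ≠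
0, div Y = tr g = 0, g ≠ 0, and the pair is generic exactly where X ∧ Y ≠ 0.

If the pair is flat, let h be the Jacobian determinant of flat coordinates. Contracting X and Y with
dx₁ ∧ dx₂ and multiplying by h gives one-forms exact in the (x₁, x₂)-directions, so X h = -(div X) h
and Y h = 0. Hence [X, Y] h = 0, and since X h ≠ 0 the fields [X, Y] and Y are parallel
(`commutator_parallel`). This is a polynomial identity in the matrix entries, and it forces every
complex eigenvector of g to be one of f (`common_zeros_of_commutator_parallel`). If X ∧ Y ≡ 0, the
same identity holds, so (ii) also yields genericity.

Conversely, suppose that all eigenvectors of g are eigenvectors of f. Then the quadratic form X ∧ Y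
is a constant multiple k of Q = x ∧ Y, with x the radial field (`minors_eq_zero_of_common_zeros`,
`exists_proportional_of_minors`). A suitable power of Q is a common integrating factor for the two
contracted forms; their primitives a, b and a rescaled x₀ are flat coordinates
(`isFlatAt_of_proportional`, `isFlatAt_of_integrating_factor`). -/

/-- Linear coordinates `x₀, x₁, x₂` on a three-dimensional space together with the dual vectors. -/
structure LinearFrame (𝕜 E : Type*) [RCLike 𝕜] [NormedAddCommGroup E] [NormedSpace 𝕜 E] where
  /-- the coordinate vectors -/
  vec : Fin 3 → E
  /-- the coordinate functions -/
  coord : Fin 3 → StrongDual 𝕜 E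
  coord_vec : ∀ i j, coord i (vec j) = if i = j then 1 else 0
  sum_coord : ∀ v, ∑ i, coord i v • vec i = v

/-- `Λ` is the wedge of `∂₀` with the linear vector field
`(m₀₀ x₁ + m₀₁ x₂) ∂₁ + (m₁₀ x₁ + m₁₁ x₂) ∂₂`. -/
def IsWedgeLinear {𝕜 E : Type*} [RCLike 𝕜] [NormedAddCommGroup E] [NormedSpace 𝕜 E]
    (B : LinearFrame 𝕜 E) (Λ : E → Bivector 𝕜 E) (m₀₀ m₀₁ m₁₀ m₁₁ : 𝕜) : Prop :=
  ∀ q ξ η, (Λ q).1 ξ η =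
    (ξ (B.vec 0) * η (B.vec 1) - ξ (B.vec 1) * η (B.vec 0)) *
        (m₀₀ * B.coord 1 q + m₀₁ * B.coord 2 q) +
      (ξ (B.vec 0) * η (B.vec 2) - ξ (B.vec 2) * η (B.vec 0)) *
        (m₁₀ * B.coord 1 q + m₁₁ * B.coord 2 q)

/-! ### Flatness forces [X, Y] to be parallel to Y. -/

section Flat

variable {𝕜 E : Type*} [RCLike 𝕜] [NormedAddCommGroup E] [NormedSpace 𝕜 E]

theorem fderiv_fderiv_apply_comm {f : E → 𝕜} {q : E} (hf : ContDiffAt 𝕜 ∞ f q) (v w : E) :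
    fderiv 𝕜 (fun y => fderiv 𝕜 f y v) q w = fderiv 𝕜 (fun y => fderiv 𝕜 f y w) q v := by
  have hd : DifferentiableAt 𝕜 (fderiv 𝕜 f) q :=
    (hf.fderiv_right (m := ∞) (by simp)).differentiableAt (by simp)
  have hs : IsSymmSndFDerivAt 𝕜 f q := hf.isSymmSndFDerivAt (by
    simpa using WithTop.coe_le_coe.2 (le_top : (2 : ℕ∞) ≤ ⊤))
  have key : ∀ v w, fderiv 𝕜 (fun y => fderiv 𝕜 f y v) q w = fderiv 𝕜 (fderiv 𝕜 f) q w v := by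
    intro v w
    rw [(hd.hasFDerivAt.clm_apply (hasFDerivAt_const v q)).fderiv]
    simp
  rw [key, key, hs.eq]

/-- The derivative of a product of `h` and a linear function. -/
theorem fderiv_mul_linear (B : LinearFrame 𝕜 E) {h : E → 𝕜} {q : E}
    (hh : DifferentiableAt 𝕜 h q) (s t : 𝕜) (v : E) :
    fderiv 𝕜 (fun y => h y * (s * B.coord 1 y + t * B.coord 2 y)) q v =
      fderiv 𝕜 h q v * (s * B.coord 1 q + t * B.coord 2 q) +
        h q * (s * B.coord 1 v + t * B.coord 2 v) := by
  have h1 : HasFDerivAt (fun y => s * B.coord 1 y + t * B.coord 2 y)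
      (s • B.coord 1 + t • B.coord 2) q :=
    (((B.coord 1).hasFDerivAt (x := q)).const_mul s).add
      (((B.coord 2).hasFDerivAt (x := q)).const_mul t)
  rw [(hh.hasFDerivAt.fun_mul h1).fderiv]
  simp
  ring

/-- If `h` times the contraction of the linear field `X` with the area form is exact, then
`X h = -(div X) h`. -/
theorem fderiv_along_eq_of_exact (B : LinearFrame 𝕜 E) {U : Set E} (hU : IsOpen U)
    {a h : E → 𝕜} (ha : ∀ q ∈ U, ContDiffAt 𝕜 ∞ a q) (hh : ∀ q ∈ U, ContDiffAt 𝕜 ∞ h q)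
    {m₀₀ m₀₁ m₁₀ m₁₁ : 𝕜}
    (h1 : ∀ q ∈ U, fderiv 𝕜 a q (B.vec 1) = h q * (-m₁₀ * B.coord 1 q + -m₁₁ * B.coord 2 q))
    (h2 : ∀ q ∈ U, fderiv 𝕜 a q (B.vec 2) = h q * (m₀₀ * B.coord 1 q + m₀₁ * B.coord 2 q))
    {q : E} (hq : q ∈ U) :
    fderiv 𝕜 h q (B.vec 1) * (m₀₀ * B.coord 1 q + m₀₁ * B.coord 2 q) +
      fderiv 𝕜 h q (B.vec 2) * (m₁₀ * B.coord 1 q + m₁₁ * B.coord 2 q) =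
        -(m₀₀ + m₁₁) * h q := by
  have hd := (hh q hq).differentiableAt (by simp)
  -- Equality of the mixed partials of a reads ∂₁(h X₁) + ∂₂(h X₂) = 0.
  have hs := fderiv_fderiv_apply_comm (ha q hq) (B.vec 1) (B.vec 2)
  have e1 : (fun y => fderiv 𝕜 a y (B.vec 1)) =ᶠ[nhds q]
      fun y => h y * (-m₁₀ * B.coord 1 y + -m₁₁ * B.coord 2 y) := by
    filter_upwards [hU.mem_nhds hq] with y hy using h1 y hy
  have e2 : (fun y => fderiv 𝕜 a y (B.vec 2)) =ᶠ[nhds q]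
      fun y => h y * (m₀₀ * B.coord 1 y + m₀₁ * B.coord 2 y) := by
    filter_upwards [hU.mem_nhds hq] with y hy using h2 y hy
  rw [e1.fderiv_eq, e2.fderiv_eq, fderiv_mul_linear B hd, fderiv_mul_linear B hd] at hs
  simp only [B.coord_vec] at hs
  simp at hs
  linear_combination -hs

/-- If `X h = -τ h` and `Y h = 0` with `τ h ≠ 0`, then `[X, Y]` and `Y` are parallel. -/
theorem commutator_parallel (B : LinearFrame 𝕜 E) {U : Set E} (hU : IsOpen U)
    {h : E → 𝕜} (hh : ∀ q ∈ U, ContDiffAt 𝕜 ∞ h q) (h0 : ∀ q ∈ U, h q ≠ 0)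
    {α β γ δ p r s τ : 𝕜} (hτ : τ ≠ 0)
    (hX : ∀ q ∈ U, fderiv 𝕜 h q (B.vec 1) * (α * B.coord 1 q + β * B.coord 2 q) +
      fderiv 𝕜 h q (B.vec 2) * (γ * B.coord 1 q + δ * B.coord 2 q) = -τ * h q)
    (hY : ∀ q ∈ U, fderiv 𝕜 h q (B.vec 1) * (p * B.coord 1 q + r * B.coord 2 q) +
      fderiv 𝕜 h q (B.vec 2) * (s * B.coord 1 q + -p * B.coord 2 q) = 0)
    {q : E} (hq : q ∈ U) {x y : 𝕜} (hx : B.coord 1 q = x) (hy : B.coord 2 q = y) :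
    (p * x + r * y) * (γ * (p * x + r * y) + δ * (s * x + -p * y)
        - s * (α * x + β * y) - -p * (γ * x + δ * y)) -
      (s * x + -p * y) * (α * (p * x + r * y) + β * (s * x + -p * y)
        - p * (α * x + β * y) - r * (γ * x + δ * y)) = 0 := by
  have hC := hh q hq
  have hd := hC.differentiableAt (by simp)
  have hd' : ∀ v, DifferentiableAt 𝕜 (fun y => fderiv 𝕜 h y v) q := fun v =>
    ((hC.fderiv_right (m := ∞) (by simp)).differentiableAt (by simp)).clm_apply
      (differentiableAt_const v)
  have hlin : ∀ s t : 𝕜, DifferentiableAt 𝕜 (fun y => s * B.coord 1 y + t * B.coord 2 y) q := by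
    intro s t; fun_prop
  have hs := fderiv_fderiv_apply_comm hC (B.vec 1) (B.vec 2)
  -- The equation M h = σ h for a linear field M, differentiated in the direction v.
  have key : ∀ (m₀₀ m₀₁ m₁₀ m₁₁ σ : 𝕜), (∀ q ∈ U,
      fderiv 𝕜 h q (B.vec 1) * (m₀₀ * B.coord 1 q + m₀₁ * B.coord 2 q) +
        fderiv 𝕜 h q (B.vec 2) * (m₁₀ * B.coord 1 q + m₁₁ * B.coord 2 q) = σ * h q) → ∀ v,
      fderiv 𝕜 (fun y => fderiv 𝕜 h y (B.vec 1)) q v * (m₀₀ * x + m₀₁ * y) +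
        fderiv 𝕜 h q (B.vec 1) * (m₀₀ * B.coord 1 v + m₀₁ * B.coord 2 v) +
        (fderiv 𝕜 (fun y => fderiv 𝕜 h y (B.vec 2)) q v * (m₁₀ * x + m₁₁ * y) +
        fderiv 𝕜 h q (B.vec 2) * (m₁₀ * B.coord 1 v + m₁₁ * B.coord 2 v)) =
          σ * fderiv 𝕜 h q v := by
    intro m₀₀ m₀₁ m₁₀ m₁₁ σ hm v
    have e : (fun q => fderiv 𝕜 h q (B.vec 1) * (m₀₀ * B.coord 1 q + m₀₁ * B.coord 2 q) +
        fderiv 𝕜 h q (B.vec 2) * (m₁₀ * B.coord 1 q + m₁₁ * B.coord 2 q)) =ᶠ[nhds q]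
        fun q => σ * h q := by
      filter_upwards [hU.mem_nhds hq] with y hy using hm y hy
    have e' := congrArg (fun T : E →L[𝕜] 𝕜 => T v) e.fderiv_eq
    rw [fderiv_fun_add ((hd' _).fun_mul (hlin _ _)) ((hd' _).fun_mul (hlin _ _)),
      add_apply, fderiv_mul_linear B (hd' _), fderiv_mul_linear B (hd' _), fderiv_const_mul hd, hx, hy] at e'
    simpa using e'
  have X1 := key α β γ δ (-τ) hX (B.vec 1)
  have X2 := key α β γ δ (-τ) hX (B.vec 2)
  have Y1 := key p r s (-p) 0 (by simpa using hY) (B.vec 1)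
  have Y2 := key p r s (-p) 0 (by simpa using hY) (B.vec 2)
  have X0 := hX q hq
  have Y0 := hY q hq
  have hne : τ * h q ≠ 0 := mul_ne_zero hτ (h0 q hq)
  rw [hx, hy] at X0 Y0
  simp only [B.coord_vec, Fin.isValue, if_true, Fin.reduceEq, if_false] at X1 X2 Y1 Y2
  set h₁ := fderiv 𝕜 h q (B.vec 1)
  set h₂ := fderiv 𝕜 h q (B.vec 2)
  set h₁₁ := fderiv 𝕜 (fun y => fderiv 𝕜 h y (B.vec 1)) q (B.vec 1)
  set h₁₂ := fderiv 𝕜 (fun y => fderiv 𝕜 h y (B.vec 1)) q (B.vec 2)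
  set h₂₁ := fderiv 𝕜 (fun y => fderiv 𝕜 h y (B.vec 2)) q (B.vec 1)
  set h₂₂ := fderiv 𝕜 (fun y => fderiv 𝕜 h y (B.vec 2)) q (B.vec 2)
  -- [X, Y] h = 0, up to sign: X(Y h) and Y(X h) = -τ Y h both vanish, and the second derivatives
  -- cancel by symmetry.
  have W : h₁ * (α * (p * x + r * y) + β * (s * x + -p * y)
        - p * (α * x + β * y) - r * (γ * x + δ * y)) +
      h₂ * (γ * (p * x + r * y) + δ * (s * x + -p * y)
        - s * (α * x + β * y) - -p * (γ * x + δ * y)) = 0 := by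
    linear_combination (p * x + r * y) * X1 + (s * x + -p * y) * X2 - (α * x + β * y) * Y1
      - (γ * x + δ * y) * Y2 - τ * Y0 +
      (-(p * x + r * y) * (γ * x + δ * y) + (s * x + -p * y) * (α * x + β * y)) * (-hs)
  set W₁ := (α * (p * x + r * y) + β * (s * x + -p * y)
        - p * (α * x + β * y) - r * (γ * x + δ * y))
  set W₂ := (γ * (p * x + r * y) + δ * (s * x + -p * y)
        - s * (α * x + β * y) - -p * (γ * x + δ * y))
  -- Cramer's rule for the system Y h = 0, [X, Y] h = 0 in the unknowns h₁, h₂; these cannot both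
  -- vanish because X h = -τ h ≠ 0.
  have z1 : h₁ * ((p * x + r * y) * W₂ - (s * x + -p * y) * W₁) = 0 := by
    linear_combination W₂ * Y0 - (s * x + -p * y) * W
  have z2 : h₂ * ((p * x + r * y) * W₂ - (s * x + -p * y) * W₁) = 0 := by
    linear_combination (p * x + r * y) * W - W₁ * Y0
  rcases mul_eq_zero.1 z1 with z1 | z1
  · rcases mul_eq_zero.1 z2 with z2 | z2
    · exact absurd (by rw [z1, z2] at X0; linear_combination X0) hne
    · exact z2
  · exact z1

/-- The Jacobian matrix of `φ` with respect to a linear frame. -/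
noncomputable def jacobian (B : LinearFrame 𝕜 E) (φ : E → Fin 3 → 𝕜) (q : E) :
    Matrix (Fin 3) (Fin 3) 𝕜 :=
  Matrix.of fun i j => coordDiff φ i q (B.vec j)

theorem LinearFrame.eq_zero_of_coord (B : LinearFrame 𝕜 E) {v : E} (h : ∀ i, B.coord i v = 0) :
    v = 0 := by
  rw [← B.sum_coord v]
  simp [h]

theorem LinearFrame.coord_sum (B : LinearFrame 𝕜 E) (w : Fin 3 → 𝕜) (i : Fin 3) :
    B.coord i (∑ j, w j • B.vec j) = w i := by
  simp [map_sum, B.coord_vec]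

theorem det_jacobian_ne_zero (B : LinearFrame 𝕜 E) {φ : E → Fin 3 → 𝕜} {q : E}
    (hφ : DifferentiableAt 𝕜 φ q) (hinj : Function.Injective (fderiv 𝕜 φ q)) :
    (jacobian B φ q).det ≠ 0 := by
  intro h0
  obtain ⟨w, hw, hw0⟩ := Matrix.exists_mulVec_eq_zero_iff.2 h0
  apply hw
  have hv : (∑ j, w j • B.vec j) = 0 := by
    apply hinj
    rw [map_zero]
    ext i
    have := congrFun hw0 i
    simp only [jacobian, coordDiff, Matrix.mulVec, dotProduct, Matrix.of_apply] at this
    rw [map_sum, Finset.sum_apply]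
    simp only [map_smul, Pi.smul_apply, smul_eq_mul, Pi.zero_apply]
    rw [Pi.zero_apply] at this
    rw [← this]
    refine Finset.sum_congr rfl fun j _ => ?_
    rw [mul_comm, fderiv_apply hφ]
    rfl
  ext i
  rw [← B.coord_sum w i, hv]
  simp

theorem injective_fderiv_of_openPartialHomeomorph {F : Type*} [NormedAddCommGroup F]
    [NormedSpace 𝕜 F] (φ : OpenPartialHomeomorph E F) {q : E} (hq : q ∈ φ.source)
    (h1 : DifferentiableAt 𝕜 φ q) (h2 : DifferentiableAt 𝕜 φ.symm (φ q)) :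
    Function.Injective (fderiv 𝕜 φ q) := by
  have hc := h2.hasFDerivAt.comp q h1.hasFDerivAt
  have hid : HasFDerivAt (φ.symm ∘ φ) (ContinuousLinearMap.id 𝕜 E) q := by
    refine (hasFDerivAt_id q).congr_of_eventuallyEq ?_
    filter_upwards [φ.open_source.mem_nhds hq] with y hy
    simpa using φ.left_inv hy
  have he := hc.unique hid
  intro v w hvw
  have e1 := congrArg (fun T : E →L[𝕜] E => T v) he
  have e2 := congrArg (fun T : E →L[𝕜] E => T w) he
  simp only [ContinuousLinearMap.comp_apply, ContinuousLinearMap.id_apply] at e1 e2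
  rw [← e1, ← e2, hvw]

theorem contDiffAt_det_jacobian (B : LinearFrame 𝕜 E) {φ : E → Fin 3 → 𝕜} {q : E}
    (hφ : ContDiffAt 𝕜 ∞ φ q) : ContDiffAt 𝕜 ∞ (fun y => (jacobian B φ y).det) q := by
  have hJ : ∀ i j, ContDiffAt 𝕜 ∞ (fun y => jacobian B φ y i j) q := by
    intro i j
    have : ContDiffAt 𝕜 ∞ (fun y => φ y i) q := contDiffAt_pi.1 hφ i
    exact (this.fderiv_right (m := ∞) (by simp)).clm_apply contDiffAt_const
  simp only [Matrix.det_fin_three]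
  have h00 := hJ 0 0
  have h01 := hJ 0 1
  have h02 := hJ 0 2
  have h10 := hJ 1 0
  have h11 := hJ 1 1
  have h12 := hJ 1 2
  have h20 := hJ 2 0
  have h21 := hJ 2 1
  have h22 := hJ 2 2
  fun_prop

/-- In coordinates where a bi-vector `∂₀ ∧ X` is constant, the contraction of `X` with the area
form becomes exact after multiplication by the Jacobian determinant. -/
theorem exists_exact_of_hasConstantCoeffs (B : LinearFrame 𝕜 E) {Λ : E → Bivector 𝕜 E}
    {m₀₀ m₀₁ m₁₀ m₁₁ : 𝕜} (hΛ : IsWedgeLinear B Λ m₀₀ m₀₁ m₁₀ m₁₁) {φ : E → Fin 3 → 𝕜}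
    {U : Set E} (hφ : ∀ q ∈ U, ContDiffAt 𝕜 ∞ φ q) (hc : HasConstantCoeffs Λ φ U) :
    ∃ a : E → 𝕜, (∀ q ∈ U, ContDiffAt 𝕜 ∞ a q) ∧
      (∀ q ∈ U, fderiv 𝕜 a q (B.vec 1) =
        (jacobian B φ q).det * (-m₁₀ * B.coord 1 q + -m₁₁ * B.coord 2 q)) ∧
      (∀ q ∈ U, fderiv 𝕜 a q (B.vec 2) =
        (jacobian B φ q).det * (m₀₀ * B.coord 1 q + m₀₁ * B.coord 2 q)) := by
  choose c hc using hc
  have hi : ∀ q ∈ U, ∀ i, ContDiffAt 𝕜 ∞ (fun y => φ y i) q := fun q hq i =>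
    contDiffAt_pi.1 (hφ q hq) i
  -- Contracting the constant bi-vector with the volume form of the coordinates φ gives a one-form
  -- with constant coefficients, hence the differential of this combination. The two volume forms
  -- differ by the Jacobian determinant.
  have hder : ∀ q ∈ U, ∀ v,
      fderiv 𝕜 (fun y => c 1 2 * φ y 0 + c 2 0 * φ y 1 + c 0 1 * φ y 2) q v =
        c 1 2 * coordDiff φ 0 q v + c 2 0 * coordDiff φ 1 q v + c 0 1 * coordDiff φ 2 q v := by
    intro q hq v
    have hd : ∀ i, HasFDerivAt (fun y => φ y i) (coordDiff φ i q) q := fun i =>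
      ((hi q hq i).differentiableAt (by simp)).hasFDerivAt
    rw [((((hd 0).const_mul (c 1 2)).fun_add ((hd 1).const_mul (c 2 0))).fun_add
      ((hd 2).const_mul (c 0 1))).fderiv]
    simp
  refine ⟨fun y => c 1 2 * φ y 0 + c 2 0 * φ y 1 + c 0 1 * φ y 2, fun q hq => ?_, fun q hq => ?_,
    fun q hq => ?_⟩
  · have h0 := hi q hq 0
    have h1 := hi q hq 1
    have h2 := hi q hq 2
    fun_prop
  · rw [hder q hq, ← hc 1 2 q hq, ← hc 2 0 q hq, ← hc 0 1 q hq, hΛ, hΛ, hΛ, Matrix.det_fin_three]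
    simp only [jacobian, Matrix.of_apply]
    ring
  · rw [hder q hq, ← hc 1 2 q hq, ← hc 2 0 q hq, ← hc 0 1 q hq, hΛ, hΛ, hΛ, Matrix.det_fin_three]
    simp only [jacobian, Matrix.of_apply]
    ring

/-- A quadratic form vanishing near a point vanishes. -/
theorem quadratic_eq_zero_of_open (B : LinearFrame 𝕜 E) {U : Set E} (hU : IsOpen U) {q : E}
    (hq : q ∈ U) {n₀ n₁ n₂ : 𝕜}
    (h : ∀ y ∈ U, n₀ * B.coord 1 y ^ 2 + n₁ * (B.coord 1 y * B.coord 2 y)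
      + n₂ * B.coord 2 y ^ 2 = 0) : n₀ = 0 ∧ n₁ = 0 ∧ n₂ = 0 := by
  -- The second difference of a quadratic form at q with increment t v is 2t² times its value at v.
  have key : ∀ v : E, n₀ * B.coord 1 v ^ 2 + n₁ * (B.coord 1 v * B.coord 2 v)
      + n₂ * B.coord 2 v ^ 2 = 0 := by
    intro v
    have c1 : ∀ᶠ t : 𝕜 in nhds 0, q + t • v ∈ U :=
      (Continuous.continuousAt (by fun_prop)).preimage_mem_nhds (by simpa using hU.mem_nhds hq)
    have c2 : ∀ᶠ t : 𝕜 in nhds 0, q - t • v ∈ U :=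
      (Continuous.continuousAt (by fun_prop)).preimage_mem_nhds (by simpa using hU.mem_nhds hq)
    obtain ⟨t, ⟨ht1, ht2⟩, ht0⟩ :=
      (((c1.and c2).filter_mono nhdsWithin_le_nhds).and
        (self_mem_nhdsWithin : ∀ᶠ t : 𝕜 in nhdsWithin 0 {0}ᶜ, t ∈ ({0}ᶜ : Set 𝕜))).exists
    have ht0 : t ≠ 0 := ht0
    have e1 := h _ ht1
    have e2 := h _ ht2
    have e0 := h _ hq
    simp only [map_add, map_sub, map_smul, smul_eq_mul] at e1 e2
    have h2 : (2 * t ^ 2 : 𝕜) ≠ 0 := mul_ne_zero two_ne_zero (pow_ne_zero _ ht0)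
    refine (mul_eq_zero.1 ?_).resolve_left h2
    linear_combination e1 + e2 - 2 * e0
  have k1 := key (B.vec 1)
  have k2 := key (B.vec 2)
  have k3 := key (B.vec 1 + B.vec 2)
  simp only [map_add, B.coord_vec, Fin.isValue, if_true, Fin.reduceEq, if_false] at k1 k2 k3
  refine ⟨by linear_combination k1, by linear_combination k3 - k1 - k2, by linear_combination k2⟩

/-- The three expressions are the coefficients of the quadratic form Y ∧ [X, Y], up to sign; it
vanishes on the whole chart because the Jacobian determinant serves both fields as integrating
factor. -/
theorem IsFlatAt.commutator_parallel (B : LinearFrame 𝕜 E) {Λ Λ₁ : E → Bivector 𝕜 E}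
    {α β γ δ p r s : 𝕜} (hτ : α + δ ≠ 0) (hΛ : IsWedgeLinear B Λ α β γ δ)
    (hΛ₁ : IsWedgeLinear B Λ₁ p r s (-p)) {q : E} (hflat : IsFlatAt Λ Λ₁ q) :
    p * (γ * p + δ * s - s * α + p * γ) - s * (β * s - r * γ) = 0 ∧
    p * (γ * r - δ * p - s * β + p * δ) + r * (γ * p + δ * s - s * α + p * γ)
      - s * (α * r - 2 * (p * β) - r * δ) + p * (β * s - r * γ) = 0 ∧
    r * (γ * r - s * β) + p * (α * r - 2 * (p * β) - r * δ) = 0 := by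
  obtain ⟨φ, hq, hφ, hφs, hc, hc₁⟩ := hflat
  have hU := φ.open_source
  have hφ' : ∀ y ∈ φ.source, ContDiffAt 𝕜 ∞ φ y := fun y hy =>
    hφ.contDiffAt (hU.mem_nhds hy)
  obtain ⟨a, ha, ha1, ha2⟩ := exists_exact_of_hasConstantCoeffs B hΛ hφ' hc
  obtain ⟨b, hb, hb1, hb2⟩ := exists_exact_of_hasConstantCoeffs B hΛ₁ hφ' hc₁
  have hh : ∀ y ∈ φ.source, ContDiffAt 𝕜 ∞ (fun y => (jacobian B φ y).det) y := fun y hy =>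
    contDiffAt_det_jacobian B (hφ' y hy)
  have h0 : ∀ y ∈ φ.source, (jacobian B φ y).det ≠ 0 := fun y hy => by
    have hd := (hφ' y hy).differentiableAt (by simp)
    refine det_jacobian_ne_zero B hd (injective_fderiv_of_openPartialHomeomorph φ hy hd ?_)
    exact (hφs.contDiffAt (φ.open_target.mem_nhds (φ.map_source hy))).differentiableAt (by simp)
  have hN := fun y hy => _root_.commutator_parallel B hU hh h0 hτ
    (fun y hy => fderiv_along_eq_of_exact B hU ha hh ha1 ha2 hy)
    (fun y hy => by simpa using fderiv_along_eq_of_exact B hU hb hh hb1 hb2 hy)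
    (q := y) hy rfl rfl
  have := quadratic_eq_zero_of_open B hU hq
    (n₀ := p * (γ * p + δ * s - s * α + p * γ) - s * (β * s - r * γ))
    (n₁ := p * (γ * r - δ * p - s * β + p * δ) + r * (γ * p + δ * s - s * α + p * γ)
      - s * (α * r - 2 * (p * β) - r * δ) + p * (β * s - r * γ))
    (n₂ := r * (γ * r - s * β) + p * (α * r - 2 * (p * β) - r * δ))
    (fun y hy => by linear_combination hN y hy)
  exact this

end Flat

/-! ### Flat coordinates from a common integrating factor. -/

section Straightening

variable {𝕜 E : Type*} [RCLike 𝕜] [NormedAddCommGroup E] [NormedSpace 𝕜 E]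

/-- Poincaré lemma for a closed one-form `f₁ dx₁ + f₂ dx₂` on a ball. -/
theorem exists_primitive_on_ball (B : LinearFrame 𝕜 E) {c : E} {ε : ℝ} {f₁ f₂ : E → 𝕜}
    (h₁ : ContDiffOn 𝕜 ∞ f₁ (Metric.ball c ε)) (h₂ : ContDiffOn 𝕜 ∞ f₂ (Metric.ball c ε))
    (hcl : ∀ q ∈ Metric.ball c ε, ∃ k₀ k₁ k₂ : 𝕜,
      HasFDerivAt f₁ (k₀ • B.coord 1 + k₁ • B.coord 2) q ∧
      HasFDerivAt f₂ (k₁ • B.coord 1 + k₂ • B.coord 2) q) :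
    ∃ F : E → 𝕜, ContDiffOn 𝕜 ∞ F (Metric.ball c ε) ∧
      ∀ q ∈ Metric.ball c ε, HasFDerivAt F (f₁ q • B.coord 1 + f₂ q • B.coord 2) q := by
  -- Convexity of the ball is a real notion, so the Poincaré lemma needs the underlying real
  -- structure even for 𝕜 = ℂ.
  let : NormedSpace ℝ E := NormedSpace.restrictScalars ℝ 𝕜 E
  have : IsScalarTower ℝ 𝕜 E := RestrictScalars.isScalarTower ℝ 𝕜 E
  have hder : ∀ q ∈ Metric.ball c ε, ∃ k₀ k₁ k₂ : 𝕜,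
      HasFDerivAt (𝕜 := 𝕜) (fun q => f₁ q • B.coord 1 + f₂ q • B.coord 2)
        ((k₀ • B.coord 1 + k₁ • B.coord 2).smulRight (B.coord 1) +
          (k₁ • B.coord 1 + k₂ • B.coord 2).smulRight (B.coord 2)) q := by
    intro q hq
    obtain ⟨k₀, k₁, k₂, e₁, e₂⟩ := hcl q hq
    exact ⟨k₀, k₁, k₂, (e₁.smul_const (B.coord 1)).fun_add (e₂.smul_const (B.coord 2))⟩
  have hdiff : DifferentiableOn ℝ (fun q => f₁ q • B.coord 1 + f₂ q • B.coord 2)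
      (Metric.ball c ε) := fun q hq => by
    obtain ⟨k₀, k₁, k₂, e⟩ := hder q hq
    exact (e.restrictScalars ℝ).differentiableAt.differentiableWithinAt
  obtain ⟨F, hF⟩ := (convex_ball c ε).exists_forall_hasFDerivAt_of_fderiv_symmetric (𝕜 := 𝕜)
    Metric.isOpen_ball hdiff
    (fun q hq v w => by
      obtain ⟨k₀, k₁, k₂, e⟩ := hder q hq
      rw [(e.restrictScalars ℝ).fderiv]
      simp
      ring)
  refine ⟨F, ?_, hF⟩
  rw [contDiffOn_infty_iff_fderiv_of_isOpen Metric.isOpen_ball]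
  refine ⟨fun q hq => (hF q hq).differentiableAt.differentiableWithinAt, ?_⟩
  refine ContDiffOn.congr (f := fun q => f₁ q • B.coord 1 + f₂ q • B.coord 2) ?_
    fun q hq => (hF q hq).fderiv
  exact (h₁.smul contDiffOn_const).add (h₂.smul contDiffOn_const)

/-- A smooth map into `𝕜³` with injective derivatives restricts to a smooth chart. -/
theorem exists_chart [FiniteDimensional 𝕜 E] (hE : Module.finrank 𝕜 E = 3) {U : Set E}
    (hU : IsOpen U) {c : E} (hc : c ∈ U) {F : E → Fin 3 → 𝕜} (hF : ContDiffOn 𝕜 ∞ F U)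
    (hinj : ∀ q ∈ U, Function.Injective (fderiv 𝕜 F q)) :
    ∃ φ : OpenPartialHomeomorph E (Fin 3 → 𝕜), (φ : E → Fin 3 → 𝕜) = F ∧ c ∈ φ.source ∧
      φ.source ⊆ U ∧ ContDiffOn 𝕜 ∞ φ φ.source ∧ ContDiffOn 𝕜 ∞ φ.symm φ.target := by
  have : CompleteSpace E := FiniteDimensional.complete 𝕜 E
  have hF' : ∀ q ∈ U, ContDiffAt 𝕜 ∞ F q := fun q hq => hF.contDiffAt (hU.mem_nhds hq)
  have hequiv : ∀ q ∈ U, ∃ e : E ≃L[𝕜] (Fin 3 → 𝕜), HasFDerivAt F (e : E →L[𝕜] Fin 3 → 𝕜) q := by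
    intro q hq
    let e : E ≃ₗ[𝕜] (Fin 3 → 𝕜) :=
      LinearEquiv.ofInjectiveOfFinrankEq (fderiv 𝕜 F q).toLinearMap (hinj q hq) (by simp [hE])
    refine ⟨e.toContinuousLinearEquiv, ?_⟩
    have : (e.toContinuousLinearEquiv : E →L[𝕜] Fin 3 → 𝕜) = fderiv 𝕜 F q := by
      ext v; rfl
    rw [this]
    exact ((hF' q hq).differentiableAt (by simp)).hasFDerivAt
  obtain ⟨e, he⟩ := hequiv c hc
  let ψ := (hF' c hc).toOpenPartialHomeomorph F he (by simp)
  refine ⟨ψ.restrOpen U hU, rfl,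
    ⟨(hF' c hc).mem_toOpenPartialHomeomorph_source he (by simp), hc⟩, fun q hq => hq.2, ?_, ?_⟩
  · exact hF.mono fun q hq => hq.2
  · intro y hy
    have hs := (ψ.restrOpen U hU).map_target hy
    obtain ⟨e', he'⟩ := hequiv _ hs.2
    exact ((ψ.restrOpen U hU).contDiffAt_symm hy he' (hF' _ hs.2)).contDiffWithinAt

theorem LinearFrame.hasFDerivAt_linear (B : LinearFrame 𝕜 E) (s t : 𝕜) (q : E) :
    HasFDerivAt (fun y => s * B.coord 1 y + t * B.coord 2 y) (s • B.coord 1 + t • B.coord 2) q :=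
  (((B.coord 1).hasFDerivAt (x := q)).const_mul s).fun_add
    (((B.coord 2).hasFDerivAt (x := q)).const_mul t)

theorem LinearFrame.contDiff_linear (B : LinearFrame 𝕜 E) (s t : 𝕜) :
    ContDiff 𝕜 ∞ (fun y => s * B.coord 1 y + t * B.coord 2 y) := by
  fun_prop

theorem LinearFrame.apply_eq (B : LinearFrame 𝕜 E) (ξ : StrongDual 𝕜 E) (v : E) :
    ξ v = ξ (B.vec 0) * B.coord 0 v + ξ (B.vec 1) * B.coord 1 v + ξ (B.vec 2) * B.coord 2 v := by
  conv_lhs => rw [← B.sum_coord v]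
  simp [Fin.sum_univ_three]
  ring

/-- If the contractions of the linear fields `X`, `Y` with the area form have a common integrating
factor `h`, then `∂₀ ∧ X` and `∂₀ ∧ Y` have constant coefficients in suitable coordinates. -/
theorem isFlatAt_of_integrating_factor [FiniteDimensional 𝕜 E] (hE : Module.finrank 𝕜 E = 3)
    (B : LinearFrame 𝕜 E) {Λ Λ₁ : E → Bivector 𝕜 E} {m₀₀ m₀₁ m₁₀ m₁₁ n₀₀ n₀₁ n₁₀ n₁₁ : 𝕜}
    (hΛ : IsWedgeLinear B Λ m₀₀ m₀₁ m₁₀ m₁₁) (hΛ₁ : IsWedgeLinear B Λ₁ n₀₀ n₀₁ n₁₀ n₁₁)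
    {U : Set E} (hU : IsOpen U) {c : E} (hc : c ∈ U) {h a b : E → 𝕜} (hh : ContDiffOn 𝕜 ∞ h U)
    (ha : ContDiffOn 𝕜 ∞ a U) (hb : ContDiffOn 𝕜 ∞ b U) (h0 : ∀ q ∈ U, h q ≠ 0)
    (hh0 : ∀ q ∈ U, fderiv 𝕜 h q (B.vec 0) = 0)
    (hD : ∀ q ∈ U, (m₀₀ * B.coord 1 q + m₀₁ * B.coord 2 q) * (n₁₀ * B.coord 1 q + n₁₁ * B.coord 2 q)
      - (m₁₀ * B.coord 1 q + m₁₁ * B.coord 2 q) * (n₀₀ * B.coord 1 q + n₀₁ * B.coord 2 q) ≠ 0)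
    (ha' : ∀ q ∈ U, HasFDerivAt a ((h q * (-m₁₀ * B.coord 1 q + -m₁₁ * B.coord 2 q)) • B.coord 1 +
      (h q * (m₀₀ * B.coord 1 q + m₀₁ * B.coord 2 q)) • B.coord 2) q)
    (hb' : ∀ q ∈ U, HasFDerivAt b ((h q * (-n₁₀ * B.coord 1 q + -n₁₁ * B.coord 2 q)) • B.coord 1 +
      (h q * (n₀₀ * B.coord 1 q + n₀₁ * B.coord 2 q)) • B.coord 2) q) :
    IsFlatAt Λ Λ₁ c := by
  set D : E → 𝕜 := fun q =>
    (m₀₀ * B.coord 1 q + m₀₁ * B.coord 2 q) * (n₁₀ * B.coord 1 q + n₁₁ * B.coord 2 q)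
      - (m₁₀ * B.coord 1 q + m₁₁ * B.coord 2 q) * (n₀₀ * B.coord 1 q + n₀₁ * B.coord 2 q) with hDdef
  have hDsm : ContDiff 𝕜 ∞ D := by
    rw [hDdef]; fun_prop
  have hD0 : ∀ q, fderiv 𝕜 D q (B.vec 0) = 0 := by
    intro q
    have := (((B.hasFDerivAt_linear m₀₀ m₀₁ q).fun_mul (B.hasFDerivAt_linear n₁₀ n₁₁ q)).fun_sub
      ((B.hasFDerivAt_linear m₁₀ m₁₁ q).fun_mul (B.hasFDerivAt_linear n₀₀ n₀₁ q))).fderiv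
    rw [hDdef, this]
    simp [B.coord_vec]
  set m : E → 𝕜 := fun q => h q * D q with hm
  have hm0 : ∀ q ∈ U, m q ≠ 0 := fun q hq => mul_ne_zero (h0 q hq) (hD q hq)
  -- With this scaling ∂₀z = 1/m, while X b = -m, Y a = m and X a = Y b = 0. As a, b do not depend
  -- on x₀, the only nonzero brackets up to skew-symmetry are Λ(b, z) = 1 and Λ₁(a, z) = -1.
  set z : E → 𝕜 := fun q => B.coord 0 q * (m q)⁻¹ with hz
  have hmsm : ContDiffOn 𝕜 ∞ m U := hh.mul hDsm.contDiffOn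
  have hzsm : ContDiffOn 𝕜 ∞ z U :=
    ((B.coord 0).contDiff.contDiffOn).mul (hmsm.inv hm0)
  have hz0 : ∀ q ∈ U, fderiv 𝕜 z q (B.vec 0) = (m q)⁻¹ := by
    intro q hq
    have dh := ((hh.contDiffAt (hU.mem_nhds hq)).differentiableAt (by simp)).hasFDerivAt
    have dD := ((hDsm.contDiffAt (x := q)).differentiableAt (by simp)).hasFDerivAt
    have dm := dh.fun_mul dD
    have dz := ((B.coord 0).hasFDerivAt (x := q)).fun_mul
      ((hasFDerivAt_inv (hm0 q hq)).comp q dm)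
    have dz' := dz.fderiv
    simp only [Function.comp_apply] at dz'
    rw [hz, dz']
    simp [B.coord_vec, hh0 q hq, hD0 q]
  let F : E → Fin 3 → 𝕜 := fun q => ![a q, b q, z q]
  have hFsm : ContDiffOn 𝕜 ∞ F U := by
    rw [contDiffOn_pi]
    intro i
    fin_cases i
    exacts [ha, hb, hzsm]
  have c0 : ∀ q ∈ U, ∀ v, coordDiff F 0 q v =
      h q * (-m₁₀ * B.coord 1 q + -m₁₁ * B.coord 2 q) * B.coord 1 v +
      h q * (m₀₀ * B.coord 1 q + m₀₁ * B.coord 2 q) * B.coord 2 v := by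
    intro q hq v
    have : coordDiff F 0 q = _ := (ha' q hq).fderiv
    rw [this]; simp
  have c1 : ∀ q ∈ U, ∀ v, coordDiff F 1 q v =
      h q * (-n₁₀ * B.coord 1 q + -n₁₁ * B.coord 2 q) * B.coord 1 v +
      h q * (n₀₀ * B.coord 1 q + n₀₁ * B.coord 2 q) * B.coord 2 v := by
    intro q hq v
    have : coordDiff F 1 q = _ := (hb' q hq).fderiv
    rw [this]; simp
  have c2 : ∀ q ∈ U, coordDiff F 2 q (B.vec 0) = (m q)⁻¹ := hz0
  obtain ⟨φ, hφF, hφc, hφU, hφ1, hφ2⟩ := exists_chart hE hU hc hFsm (by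
    intro q hq
    rw [injective_iff_map_eq_zero]
    intro v hv
    have hv' : ∀ i, coordDiff F i q v = 0 := fun i => by
      have hd := (hFsm.contDiffAt (hU.mem_nhds hq)).differentiableAt (by simp)
      rw [coordDiff, fderiv_apply hd]
      simpa using congrFun hv i
    have e0 := hv' 0
    have e1 := hv' 1
    have e2 := hv' 2
    rw [c0 q hq] at e0
    rw [c1 q hq] at e1
    have v1 : B.coord 1 v = 0 := by
      refine (mul_eq_zero.1 ?_).resolve_left (hm0 q hq)
      simp only [hm, hDdef]
      linear_combination (m₀₀ * B.coord 1 q + m₀₁ * B.coord 2 q) * (-e1) +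
        (n₀₀ * B.coord 1 q + n₀₁ * B.coord 2 q) * e0
    have v2 : B.coord 2 v = 0 := by
      refine (mul_eq_zero.1 ?_).resolve_left (hm0 q hq)
      simp only [hm, hDdef]
      linear_combination (n₁₀ * B.coord 1 q + n₁₁ * B.coord 2 q) * e0 -
        (m₁₀ * B.coord 1 q + m₁₁ * B.coord 2 q) * e1
    have v0 : B.coord 0 v = 0 := by
      rw [B.apply_eq, v1, v2, c2 q hq] at e2
      refine (mul_eq_zero.1 ?_).resolve_left (inv_ne_zero (hm0 q hq))
      linear_combination e2
    refine B.eq_zero_of_coord fun i => ?_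
    fin_cases i
    exacts [v0, v1, v2])
  have hinv : ∀ q ∈ U, (m q)⁻¹ * (h q * D q) = 1 := fun q hq => inv_mul_cancel₀ (hm0 q hq)
  refine ⟨φ, hφc, hφ1, hφ2, ?_, ?_⟩
  · rw [hφF]
    have key : ∀ q ∈ φ.source, ∀ i j, (Λ q).1 (coordDiff F i q) (coordDiff F j q) =
        !![0, 0, 0; 0, 0, 1; 0, -1, 0] i j := by
      intro q hq i j
      have hqU := hφU hq
      have hi := hinv q hqU
      simp only [hDdef] at hi
      rw [hΛ]
      fin_cases i <;> fin_cases j <;>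
        simp [c0 q hqU, c1 q hqU, c2 q hqU, B.coord_vec] <;>
        first | ring1 | linear_combination hi | linear_combination -hi
    exact fun i j => ⟨_, fun q hq => key q hq i j⟩
  · rw [hφF]
    have key : ∀ q ∈ φ.source, ∀ i j, (Λ₁ q).1 (coordDiff F i q) (coordDiff F j q) =
        !![0, 0, -1; 0, 0, 0; 1, 0, 0] i j := by
      intro q hq i j
      have hqU := hφU hq
      have hi := hinv q hqU
      simp only [hDdef] at hi
      rw [hΛ₁]
      fin_cases i <;> fin_cases j <;>
        simp [c0 q hqU, c1 q hqU, c2 q hqU, B.coord_vec] <;>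
        first | ring1 | linear_combination hi | linear_combination -hi
    exact fun i j => ⟨_, fun q hq => key q hq i j⟩

/-- If `h⁻¹ dh` is the multiple `κ / Q` of the contraction of `Y` with the area form, then `h` is an
integrating factor for each linear field `M` with `κ (M₁ Y₂ - M₂ Y₁) = -(div M) Q`. -/
theorem exists_primitive_integrating_factor (B : LinearFrame 𝕜 E) {c : E} {ε : ℝ} {h g : E → 𝕜}
    (hh : ContDiffOn 𝕜 ∞ h (Metric.ball c ε)) {p r s : 𝕜}
    (hh' : ∀ q ∈ Metric.ball c ε, HasFDerivAt h ((h q * g q * (s * B.coord 1 q + -p * B.coord 2 q)) •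
      B.coord 1 + (-(h q * g q * (p * B.coord 1 q + r * B.coord 2 q))) • B.coord 2) q)
    {m₀₀ m₀₁ m₁₀ m₁₁ : 𝕜}
    (hm : ∀ q ∈ Metric.ball c ε, g q *
      ((m₀₀ * B.coord 1 q + m₀₁ * B.coord 2 q) * (s * B.coord 1 q + -p * B.coord 2 q)
      - (m₁₀ * B.coord 1 q + m₁₁ * B.coord 2 q) * (p * B.coord 1 q + r * B.coord 2 q)) =
        -(m₀₀ + m₁₁)) :
    ∃ a : E → 𝕜, ContDiffOn 𝕜 ∞ a (Metric.ball c ε) ∧ ∀ q ∈ Metric.ball c ε,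
      HasFDerivAt a ((h q * (-m₁₀ * B.coord 1 q + -m₁₁ * B.coord 2 q)) • B.coord 1 +
        (h q * (m₀₀ * B.coord 1 q + m₀₁ * B.coord 2 q)) • B.coord 2) q := by
  refine exists_primitive_on_ball B (hh.mul (B.contDiff_linear _ _).contDiffOn)
    (hh.mul (B.contDiff_linear _ _).contDiffOn) fun q hq => ?_
  have d1 := (hh' q hq).fun_mul (B.hasFDerivAt_linear (-m₁₀) (-m₁₁) q)
  have d2 := (hh' q hq).fun_mul (B.hasFDerivAt_linear m₀₀ m₀₁ q)
  have hmq := hm q hq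
  -- The blank in the second derivative is unified with the mixed coefficient of the first, so the
  -- last goal is closedness of the form; it amounts to `hm`.
  refine ⟨_, _, _, d1.congr_fderiv (g' := (h q * -m₁₀ +
      (-m₁₀ * B.coord 1 q + -m₁₁ * B.coord 2 q) *
        (h q * g q * (s * B.coord 1 q + -p * B.coord 2 q))) • B.coord 1 + (h q * -m₁₁ +
      (-m₁₀ * B.coord 1 q + -m₁₁ * B.coord 2 q) *
        -(h q * g q * (p * B.coord 1 q + r * B.coord 2 q))) • B.coord 2) ?_,
    d2.congr_fderiv (g' := _ + (h q * m₀₁ +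
      (m₀₀ * B.coord 1 q + m₀₁ * B.coord 2 q) *
        -(h q * g q * (p * B.coord 1 q + r * B.coord 2 q))) • B.coord 2) ?_⟩
  · ext v
    simp
    ring
  · ext v
    simp
    linear_combination (h q * B.coord 1 v) * hmq

/-- If `X ∧ Y` is a constant multiple of `x ∧ Y` for the radial field `x` and a divergence-free
linear field `Y`, then the pair `∂₀ ∧ X`, `∂₀ ∧ Y` is flat where `X ∧ Y` does not vanish. -/
theorem isFlatAt_of_proportional [FiniteDimensional 𝕜 E] (hE : Module.finrank 𝕜 E = 3)
    (B : LinearFrame 𝕜 E) {Λ Λ₁ : E → Bivector 𝕜 E} {α β γ δ p r s k : 𝕜}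
    (hΛ : IsWedgeLinear B Λ α β γ δ) (hΛ₁ : IsWedgeLinear B Λ₁ p r s (-p))
    (hprop : ∀ x y : 𝕜, (α * x + β * y) * (s * x + -p * y) - (γ * x + δ * y) * (p * x + r * y) =
      k * (x * (s * x + -p * y) - y * (p * x + r * y)))
    {c : E} (hc : (α * B.coord 1 c + β * B.coord 2 c) * (s * B.coord 1 c + -p * B.coord 2 c)
      - (γ * B.coord 1 c + δ * B.coord 2 c) * (p * B.coord 1 c + r * B.coord 2 c) ≠ 0) :
    IsFlatAt Λ Λ₁ c := by
  -- As div Y = 0, Q/2 is a Hamiltonian of Y: ∂₁Q = 2Y₂ and ∂₂Q = -2Y₁.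
  set Q : E → 𝕜 := fun q => B.coord 1 q * (s * B.coord 1 q + -p * B.coord 2 q) -
    B.coord 2 q * (p * B.coord 1 q + r * B.coord 2 q) with hQ
  have hkQ : k * Q c ≠ 0 := by rw [hQ, ← hprop]; exact hc
  have hk : k ≠ 0 := left_ne_zero_of_mul hkQ
  have hQsm : ContDiff 𝕜 ∞ Q := by rw [hQ]; fun_prop
  obtain ⟨ε, hε, hball⟩ := Metric.isOpen_iff.1
    (isOpen_ne_fun hQsm.continuous continuous_const) c (right_ne_zero_of_mul hkQ)
  have hQ0 : ∀ q ∈ Metric.ball c ε, Q q ≠ 0 := fun q hq => hball hq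
  have hQd : ∀ q, HasFDerivAt Q ((2 * (s * B.coord 1 q + -p * B.coord 2 q)) • B.coord 1 +
      (-(2 * (p * B.coord 1 q + r * B.coord 2 q))) • B.coord 2) q := by
    intro q
    refine ((((B.coord 1).hasFDerivAt (x := q)).fun_mul (B.hasFDerivAt_linear s (-p) q)).fun_sub
      (((B.coord 2).hasFDerivAt (x := q)).fun_mul (B.hasFDerivAt_linear p r q))).congr_fderiv ?_
    ext v
    simp
    ring
  have hQinv : ∀ q ∈ Metric.ball c ε, HasFDerivAt (fun q => (Q q)⁻¹)
      ((-(Q q ^ 2)⁻¹) • ((2 * (s * B.coord 1 q + -p * B.coord 2 q)) • B.coord 1 +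
      (-(2 * (p * B.coord 1 q + r * B.coord 2 q))) • B.coord 2)) q := fun q hq =>
    ((hasDerivAt_inv (hQ0 q hq)).comp_hasFDerivAt q (hQd q))
  have hQism : ContDiffOn 𝕜 ∞ (fun q => (Q q)⁻¹) (Metric.ball c ε) := hQsm.contDiffOn.inv hQ0
  -- ℓ is a local ½ log Q; the Poincaré lemma spares the choice of a branch or of a sign of Q.
  obtain ⟨ℓ, hℓ, hℓ'⟩ := exists_primitive_on_ball B (c := c) (ε := ε)
    (f₁ := fun q => (Q q)⁻¹ * (s * B.coord 1 q + -p * B.coord 2 q))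
    (f₂ := fun q => (Q q)⁻¹ * (-p * B.coord 1 q + -r * B.coord 2 q))
    (hQism.mul (B.contDiff_linear _ _).contDiffOn) (hQism.mul (B.contDiff_linear _ _).contDiffOn)
    (fun q hq => by
      have d1 := (hQinv q hq).fun_mul (B.hasFDerivAt_linear s (-p) q)
      have d2 := (hQinv q hq).fun_mul (B.hasFDerivAt_linear (-p) (-r) q)
      refine ⟨_, _, _, d1.congr_fderiv (g' :=
        ((Q q)⁻¹ * s - (Q q ^ 2)⁻¹ * (2 * (s * B.coord 1 q + -p * B.coord 2 q) *
          (s * B.coord 1 q + -p * B.coord 2 q))) • B.coord 1 +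
        ((Q q)⁻¹ * -p + (Q q ^ 2)⁻¹ * (2 * (s * B.coord 1 q + -p * B.coord 2 q) *
          (p * B.coord 1 q + r * B.coord 2 q))) • B.coord 2) ?_,
        d2.congr_fderiv (g' := _ + ((Q q)⁻¹ * -r - (Q q ^ 2)⁻¹ *
          (2 * (p * B.coord 1 q + r * B.coord 2 q) *
          (p * B.coord 1 q + r * B.coord 2 q))) • B.coord 2) ?_⟩
      · ext v
        simp
        ring
      · ext v
        simp
        ring)
  -- Since X ℓ = k and Y ℓ = 0, this exponent makes exp(κℓ), a branch of a multiple of Q^(κ/2),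
  -- satisfy X h = -(α + δ) h and Y h = 0.
  set κ : 𝕜 := -(α + δ) / k with hκ
  have hexp : ContDiff 𝕜 ∞ (NormedSpace.exp : 𝕜 → 𝕜) := contDiff_iff_contDiffAt.2 fun x =>
    (NormedSpace.exp_analytic (𝕂 := 𝕜) x).contDiffAt
  set h : E → 𝕜 := fun q => NormedSpace.exp (κ * ℓ q) with hh
  have hhsm : ContDiffOn 𝕜 ∞ h (Metric.ball c ε) :=
    hexp.comp_contDiffOn (contDiffOn_const.mul hℓ)
  have hh0 : ∀ q, h q ≠ 0 := fun q => (NormedSpace.isUnit_exp (κ * ℓ q)).ne_zero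
  have hh' : ∀ q ∈ Metric.ball c ε, HasFDerivAt h
      ((h q * (κ * (Q q)⁻¹) * (s * B.coord 1 q + -p * B.coord 2 q)) •
      B.coord 1 + (-(h q * (κ * (Q q)⁻¹) * (p * B.coord 1 q + r * B.coord 2 q))) • B.coord 2) q := by
    intro q hq
    refine ((hasDerivAt_exp (x := κ * ℓ q)).comp_hasFDerivAt q
      ((hℓ' q hq).const_mul κ)).congr_fderiv ?_
    ext v
    simp [hh]
    ring
  obtain ⟨a, ha, ha'⟩ := exists_primitive_integrating_factor B hhsm hh'
    (m₀₀ := α) (m₀₁ := β) (m₁₀ := γ) (m₁₁ := δ) (fun q hq => by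
      rw [hprop, hκ]
      have := hQ0 q hq
      change -(α + δ) / k * (Q q)⁻¹ * (k * Q q) = -(α + δ)
      field_simp)
  obtain ⟨b, hb, hb'⟩ := exists_primitive_integrating_factor B hhsm hh'
    (m₀₀ := p) (m₀₁ := r) (m₁₀ := s) (m₁₁ := -p) (fun q hq => by ring)
  refine isFlatAt_of_integrating_factor hE B hΛ hΛ₁ Metric.isOpen_ball (Metric.mem_ball_self hε)
    hhsm ha hb (fun q _ => hh0 q) (fun q hq => ?_) (fun q hq => ?_) ha' hb'
  · rw [(hh' q hq).fderiv]
    simp [B.coord_vec]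
  · rw [hprop]
    exact mul_ne_zero hk (hQ0 q hq)

end Straightening

/-! ### Common eigenvectors of two 2 × 2 matrices. -/

section Algebra

/-- If every zero of the quadratic form `v ∧ g v` is a zero of `v ∧ f v`, for `g ≠ 0` traceless,
then the quadratic forms `fᵀw ∧ gᵀw` and `w ∧ gᵀw` have proportional coefficients. -/
theorem minors_eq_zero_of_common_zeros {K : Type*} [Field K] [IsAlgClosed K] [NeZero (2 : K)]
    {α β γ δ p r s : K}
    (h : ∀ v₁ v₂ : K, (v₁ ≠ 0 ∨ v₂ ≠ 0) → v₁ * (r * v₁ + -p * v₂) - v₂ * (p * v₁ + s * v₂) = 0 →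
      v₁ * (β * v₁ + δ * v₂) - v₂ * (α * v₁ + γ * v₂) = 0) :
    (α * s - γ * p) * (-2 * p) = s * (β * s - α * p - γ * r - δ * p) ∧
    (α * s - γ * p) * r = s * (β * p + δ * r) ∧
    (β * s - α * p - γ * r - δ * p) * r = (-2 * p) * (β * p + δ * r) := by
  have h2 : (2 : K) ≠ 0 := NeZero.ne 2
  -- For r = 0 the first basis vector is an eigenvector of g, and for p ≠ 0 the other one is (s,
  -- -2p).
  by_cases hr : r = 0
  · subst hr
    have hβ : β = 0 := by
      have := h 1 0 (Or.inl one_ne_zero) (by ring)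
      linear_combination this
    subst hβ
    by_cases hp : p = 0
    · subst hp
      refine ⟨by ring, by ring, by ring⟩
    · have e := h s (-2 * p) (Or.inr (mul_ne_zero (neg_ne_zero.2 h2) hp)) (by ring)
      have e' : s * (δ - α) + 2 * p * γ = 0 := by
        refine (mul_eq_zero.1 ?_).resolve_left (mul_ne_zero (neg_ne_zero.2 h2) hp)
        linear_combination e
      refine ⟨by linear_combination p * e', by ring, by ring⟩
  · obtain ⟨t, ht⟩ := IsAlgClosed.exists_pow_nat_eq (p ^ 2 + r * s) (n := 2) two_pos
    have e1 := h (p + t) r (Or.inr hr) (by linear_combination r * ht)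
    have e2 := h (p - t) r (Or.inr hr) (by linear_combination r * ht)
    have m3 : (β * s - α * p - γ * r - δ * p) * r = (-2 * p) * (β * p + δ * r) := by
      refine mul_left_cancel₀ h2 ?_
      linear_combination e1 + e2 - 2 * β * ht
    have m2 : (α * s - γ * p) * r = s * (β * p + δ * r) := by
      by_cases ht0 : t = 0
      · subst ht0
        refine mul_left_cancel₀ hr ?_
        linear_combination (α * r - δ * r - β * p) * (-ht) + p * e1
      · have d : 2 * β * p + (δ - α) * r = 0 := by
          refine (mul_eq_zero.1 ?_).resolve_left (mul_ne_zero h2 ht0)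
          linear_combination e1 - e2
        refine mul_left_cancel₀ hr ?_
        linear_combination p * m3 - (r * s + p ^ 2) * d
    refine ⟨?_, m2, m3⟩
    refine mul_left_cancel₀ hr ?_
    linear_combination (-2 * p) * m2 - s * m3

/-- Two coefficient vectors with vanishing minors are proportional. -/
theorem exists_proportional_of_minors {K : Type*} [Field K] [NeZero (2 : K)]
    {α β γ δ p r s : K} (h0 : p ≠ 0 ∨ r ≠ 0 ∨ s ≠ 0)
    (m1 : (α * s - γ * p) * (-2 * p) = s * (β * s - α * p - γ * r - δ * p))
    (m2 : (α * s - γ * p) * r = s * (β * p + δ * r))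
    (m3 : (β * s - α * p - γ * r - δ * p) * r = (-2 * p) * (β * p + δ * r)) :
    ∃ k : K, ∀ x y : K,
      (α * x + β * y) * (s * x + -p * y) - (γ * x + δ * y) * (p * x + r * y) =
        k * (x * (s * x + -p * y) - y * (p * x + r * y)) := by
  have h2 : (2 : K) ≠ 0 := NeZero.ne 2
  rcases h0 with hp | hr | hs
  · refine ⟨(β * s - α * p - γ * r - δ * p) / (-2 * p), fun x y => ?_⟩
    have hp2 : -2 * p ≠ 0 := mul_ne_zero (neg_ne_zero.2 h2) hp
    refine mul_left_cancel₀ hp2 ?_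
    rw [← mul_assoc, mul_div_cancel₀ _ hp2]
    linear_combination x ^ 2 * m1 + y ^ 2 * m3
  · refine ⟨(β * p + δ * r) / r, fun x y => ?_⟩
    refine mul_left_cancel₀ hr ?_
    rw [← mul_assoc, mul_div_cancel₀ _ hr]
    linear_combination x ^ 2 * m2 + x * y * m3
  · refine ⟨(α * s - γ * p) / s, fun x y => ?_⟩
    refine mul_left_cancel₀ hs ?_
    rw [← mul_assoc, mul_div_cancel₀ _ hs]
    linear_combination (-x * y) * m1 + y ^ 2 * m2

/-- If `[f, g]ᵀw ∧ gᵀw` vanishes identically, for `g ≠ 0` traceless, then every eigenvector of `g`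
is an eigenvector of `f`. -/
theorem common_zeros_of_commutator_parallel {K : Type*} [Field K] [NeZero (2 : K)]
    {α β γ δ p r s : K} (h0 : p ≠ 0 ∨ r ≠ 0 ∨ s ≠ 0)
    (n0 : p * (γ * p + δ * s - s * α + p * γ) - s * (β * s - r * γ) = 0)
    (n1 : p * (γ * r - δ * p - s * β + p * δ) + r * (γ * p + δ * s - s * α + p * γ)
      - s * (α * r - 2 * (p * β) - r * δ) + p * (β * s - r * γ) = 0)
    (n2 : r * (γ * r - s * β) + p * (α * r - 2 * (p * β) - r * δ) = 0)
    {v₁ v₂ : K} (hS : v₁ * (r * v₁ + -p * v₂) - v₂ * (p * v₁ + s * v₂) = 0) :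
    v₁ * (β * v₁ + δ * v₂) - v₂ * (α * v₁ + γ * v₂) = 0 := by
  have h2 : (2 : K) ≠ 0 := NeZero.ne 2
  -- p² + rs = -det g. If it is zero, g is nilpotent and its eigenvectors are the nonzero vectors of
  -- its kernel.
  by_cases hΔ : p ^ 2 + r * s = 0
  · have z1 : r * v₁ - p * v₂ = 0 := by
      refine pow_eq_zero_iff (two_ne_zero) |>.1 ?_
      linear_combination r * hS + v₂ ^ 2 * hΔ
    have z2 : p * v₁ + s * v₂ = 0 := by
      refine pow_eq_zero_iff (two_ne_zero) |>.1 ?_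
      linear_combination -s * hS + v₁ ^ 2 * hΔ
    by_cases hr : r = 0
    · have hp : p = 0 := by simpa [hr] using hΔ
      have hs : s ≠ 0 := by simpa [hr, hp] using h0
      subst hr hp
      have hβ : β = 0 := by
        refine (mul_eq_zero.1 ?_).resolve_left (mul_ne_zero hs hs)
        linear_combination -n0
      have hv : v₂ = 0 := (mul_eq_zero.1 (by linear_combination z2 : s * v₂ = 0)).resolve_left hs
      rw [hβ, hv]
      ring
    · refine (mul_eq_zero.1 ?_).resolve_left (mul_ne_zero hr hr)
      linear_combination (β * (r * v₁ + p * v₂) + (δ - α) * r * v₂) * z1 - v₂ ^ 2 * n2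
        - v₂ ^ 2 * β * hΔ
  · have hΔ2 : 2 * (p ^ 2 + r * s) ≠ 0 := mul_ne_zero h2 hΔ
    -- `k1`, `k2`, `k3` say that f and g commute: g is invertible, so [f, g] is a multiple of g, and
    -- tr([f, g] g) = 0 while tr g² = 2(p² + rs) ≠ 0. A matrix commuting with the non-scalar g is a
    -- polynomial in g.
    have k1 : r * γ - s * β = 0 := by
      refine (mul_eq_zero.1 ?_).resolve_left hΔ2
      linear_combination r * n0 + s * n2
    have k2 : 2 * p * γ + s * (δ - α) = 0 := by
      refine (mul_eq_zero.1 ?_).resolve_left hΔ2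
      linear_combination s * n1 + 2 * p * n0
    have k3 : 2 * p * β + r * (δ - α) = 0 := by
      refine (mul_eq_zero.1 ?_).resolve_left hΔ2
      linear_combination r * n1 - 2 * p * n2
    rcases h0 with hp | hr | hs
    · refine (mul_eq_zero.1 ?_).resolve_left (mul_ne_zero h2 hp)
      linear_combination -(δ - α) * hS + v₁ ^ 2 * k3 - v₂ ^ 2 * k2
    · refine (mul_eq_zero.1 ?_).resolve_left hr
      linear_combination β * hS + v₁ * v₂ * k3 - v₂ ^ 2 * k1
    · refine (mul_eq_zero.1 ?_).resolve_left hs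
      linear_combination γ * hS + v₁ * v₂ * k2 - v₁ ^ 2 * k1

/-- Eigenvectors in coordinates with respect to a basis of the two-dimensional space `J`. -/
theorem isComplexEigenvector_iff {𝕜 J : Type*} [Field 𝕜] [Algebra 𝕜 ℂ] [AddCommGroup J]
    [Module 𝕜 J] (e : Module.Basis (Fin 2) 𝕜 J) {f : Module.End 𝕜 J} {α β γ δ : 𝕜}
    (h0 : f (e 0) = α • e 0 + β • e 1) (h1 : f (e 1) = γ • e 0 + δ • e 1) (v₁ v₂ : ℂ) :
    IsComplexEigenvector f (v₁ ⊗ₜ[𝕜] e 0 + v₂ ⊗ₜ[𝕜] e 1) ↔ (v₁ ≠ 0 ∨ v₂ ≠ 0) ∧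
      v₁ * (algebraMap 𝕜 ℂ β * v₁ + algebraMap 𝕜 ℂ δ * v₂) -
        v₂ * (algebraMap 𝕜 ℂ α * v₁ + algebraMap 𝕜 ℂ γ * v₂) = 0 := by
  set eC := Algebra.TensorProduct.basis ℂ e with heC
  have hv : ∀ a b : ℂ, a ⊗ₜ[𝕜] e 0 + b ⊗ₜ[𝕜] e 1 = a • eC 0 + b • eC 1 := by
    intro a b
    simp [heC, TensorProduct.smul_tmul']
  have hext : ∀ a b a' b' : ℂ, a • eC 0 + b • eC 1 = a' • eC 0 + b' • eC 1 ↔ a = a' ∧ b = b' := by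
    intro a b a' b'
    constructor
    · intro h
      have r0 := congrArg (fun x => eC.repr x 0) h
      have r1 := congrArg (fun x => eC.repr x 1) h
      simpa using And.intro r0 r1
    · rintro ⟨rfl, rfl⟩
      rfl
  have hf : f.baseChange ℂ (v₁ ⊗ₜ[𝕜] e 0 + v₂ ⊗ₜ[𝕜] e 1) =
      (algebraMap 𝕜 ℂ α * v₁ + algebraMap 𝕜 ℂ γ * v₂) • eC 0 +
      (algebraMap 𝕜 ℂ β * v₁ + algebraMap 𝕜 ℂ δ * v₂) • eC 1 := by
    rw [← hv, map_add, LinearMap.baseChange_tmul, LinearMap.baseChange_tmul, h0, h1]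
    simp only [TensorProduct.tmul_add, TensorProduct.tmul_smul, TensorProduct.add_tmul,
      ← Algebra.smul_def, TensorProduct.smul_tmul']
    abel
  have hne : (v₁ ⊗ₜ[𝕜] e 0 + v₂ ⊗ₜ[𝕜] e 1 ≠ 0) ↔ (v₁ ≠ 0 ∨ v₂ ≠ 0) := by
    have := hext v₁ v₂ 0 0
    rw [hv, Ne, ← not_and_or, ← this]
    simp
  simp only [IsComplexEigenvector, Module.End.hasEigenvector_iff, Module.End.mem_eigenspace_iff, hne]
  rw [exists_and_right, and_comm]
  refine and_congr_right fun hv0 => ?_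
  simp only [hf]
  simp only [hv, smul_add, smul_smul, hext]
  constructor
  · rintro ⟨μ, e1, e2⟩
    rw [e1, e2]
    ring
  · intro h
    by_cases h1 : v₁ = 0
    · have h2 : v₂ ≠ 0 := hv0.resolve_left (by simp [h1])
      refine ⟨(algebraMap 𝕜 ℂ β * v₁ + algebraMap 𝕜 ℂ δ * v₂) / v₂, ?_, by field_simp⟩
      field_simp
      linear_combination -h
    · refine ⟨(algebraMap 𝕜 ℂ α * v₁ + algebraMap 𝕜 ℂ γ * v₂) / v₁, by field_simp, ?_⟩
      field_simp
      linear_combination h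

theorem exists_tmul_add_tmul_eq {𝕜 J : Type*} [Field 𝕜] [Algebra 𝕜 ℂ] [AddCommGroup J]
    [Module 𝕜 J] (e : Module.Basis (Fin 2) 𝕜 J) (v : ℂ ⊗[𝕜] J) :
    ∃ v₁ v₂ : ℂ, v₁ ⊗ₜ[𝕜] e 0 + v₂ ⊗ₜ[𝕜] e 1 = v := by
  refine ⟨(Algebra.TensorProduct.basis ℂ e).repr v 0, (Algebra.TensorProduct.basis ℂ e).repr v 1, ?_⟩
  conv_rhs => rw [← (Algebra.TensorProduct.basis ℂ e).sum_repr v]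
  simp [Fin.sum_univ_two, TensorProduct.smul_tmul']

end Algebra

/-! ### Lie–Poisson structures and genericity in linear coordinates. -/

section NormalForm

variable {𝕜 A : Type*} [RCLike 𝕜] [NormedAddCommGroup A] [NormedSpace 𝕜 A]
  [FiniteDimensional 𝕜 A]

/-- The linear coordinates on `A*` given by a basis of `A`. -/
noncomputable def LinearFrame.ofBasis (b : Module.Basis (Fin 3) 𝕜 A) :
    LinearFrame 𝕜 (StrongDual 𝕜 A) where
  vec j := (b.coord j).toContinuousLinearMap
  coord i := ContinuousLinearMap.apply 𝕜 𝕜 (b i)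
  coord_vec i j := by simp [Finsupp.single_apply]
  sum_coord p := by
    ext a
    conv_rhs => rw [← b.sum_repr a, map_sum]
    simp [Fin.sum_univ_three]
    ring

theorem LinearFrame.ofBasis_coord (b : Module.Basis (Fin 3) 𝕜 A) (i : Fin 3)
    (p : StrongDual 𝕜 A) : (LinearFrame.ofBasis b).coord i p = p (b i) := rfl

theorem ofBidual_eq_sum (b : Module.Basis (Fin 3) 𝕜 A) (ξ : StrongDual 𝕜 (StrongDual 𝕜 A)) :
    ofBidual ξ = ξ ((LinearFrame.ofBasis b).vec 0) • b 0 +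
      ξ ((LinearFrame.ofBasis b).vec 1) • b 1 + ξ ((LinearFrame.ofBasis b).vec 2) • b 2 := by
  conv_lhs => rw [← b.sum_repr (ofBidual ξ)]
  have h : ∀ i, b.repr (ofBidual ξ) i = ξ ((LinearFrame.ofBasis b).vec i) := fun i =>
    apply_ofBidual (b.coord i).toContinuousLinearMap ξ
  simp only [Fin.sum_univ_three, h]

/-- Only brackets with b₀ survive, and they take values in the span of b₁, b₂; this gives ∂₀ ∧ X
with X the transpose of [b₀, ·] on that span. -/
theorem isWedgeLinear_liePoisson (L : LieBracket 𝕜 A) (b : Module.Basis (Fin 3) 𝕜 A)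
    {α β γ δ : 𝕜} (h1 : L.ad (b 0) (b 1) = α • b 1 + β • b 2)
    (h2 : L.ad (b 0) (b 2) = γ • b 1 + δ • b 2) (h12 : L.ad (b 1) (b 2) = 0) :
    IsWedgeLinear (LinearFrame.ofBasis b) (liePoisson L) α β γ δ := by
  intro q ξ η
  change q (L.ad (ofBidual ξ) (ofBidual η)) = _
  rw [ofBidual_eq_sum b ξ, ofBidual_eq_sum b η]
  simp only [map_add, map_smul, LinearMap.add_apply, LinearMap.smul_apply, L.self_eq_zero,
    L.skew (b 1) (b 0), L.skew (b 2) (b 0), L.skew (b 2) (b 1), h1, h2, h12,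
    LinearFrame.ofBasis_coord, smul_eq_mul, map_zero, map_neg]
  ring

/-- Both bi-vectors contain the factor ∂₀, so genericity is linear independence of X and Y at q. The
determinant lies in 𝕜, so independence over 𝕜 and over ℂ agree. -/
theorem isGenericAt_iff {E : Type*} [NormedAddCommGroup E] [NormedSpace 𝕜 E] [Algebra 𝕜 ℂ]
    (B : LinearFrame 𝕜 E) {Λ Λ₁ : E → Bivector 𝕜 E} {m₀₀ m₀₁ m₁₀ m₁₁ n₀₀ n₀₁ n₁₀ n₁₁ : 𝕜}
    (hΛ : IsWedgeLinear B Λ m₀₀ m₀₁ m₁₀ m₁₁) (hΛ₁ : IsWedgeLinear B Λ₁ n₀₀ n₀₁ n₁₀ n₁₁) (q : E) :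
    IsGenericAt Λ Λ₁ q ↔
      (m₀₀ * B.coord 1 q + m₀₁ * B.coord 2 q) * (n₁₀ * B.coord 1 q + n₁₁ * B.coord 2 q)
      - (m₁₀ * B.coord 1 q + m₁₁ * B.coord 2 q) * (n₀₀ * B.coord 1 q + n₀₁ * B.coord 2 q) ≠ 0 := by
  unfold IsGenericAt
  set X₁ := m₀₀ * B.coord 1 q + m₀₁ * B.coord 2 q with hX₁
  set X₂ := m₁₀ * B.coord 1 q + m₁₁ * B.coord 2 q with hX₂
  set Y₁ := n₀₀ * B.coord 1 q + n₀₁ * B.coord 2 q with hY₁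
  set Y₂ := n₁₀ * B.coord 1 q + n₁₁ * B.coord 2 q with hY₂
  constructor
  · intro h hD
    have key : ∀ s t : 𝕜, s * X₁ + t * Y₁ = 0 → s * X₂ + t * Y₂ = 0 → s = 0 ∧ t = 0 := by
      intro s t e1 e2
      by_contra hst
      obtain ⟨ξ, η, hne⟩ := h (algebraMap 𝕜 ℂ s) (algebraMap 𝕜 ℂ t) (by
        simpa [Prod.ext_iff] using hst)
      apply hne
      rw [← map_mul, ← map_mul, ← map_add, hΛ, hΛ₁, ← hX₁, ← hX₂, ← hY₁, ← hY₂]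
      rw [← map_zero (algebraMap 𝕜 ℂ)]
      congr 1
      linear_combination (ξ (B.vec 0) * η (B.vec 1) - ξ (B.vec 1) * η (B.vec 0)) * e1 +
        (ξ (B.vec 0) * η (B.vec 2) - ξ (B.vec 2) * η (B.vec 0)) * e2
    -- A zero determinant makes (Y₁, -X₁) and (Y₂, -X₂) linear relations between X and Y, so X = Y =
    -- 0; then (1, 0) is a nontrivial relation.
    obtain ⟨y1, x1⟩ := key Y₁ (-X₁) (by ring) (by linear_combination -hD)
    obtain ⟨y2, x2⟩ := key Y₂ (-X₂) (by linear_combination hD) (by ring)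
    have := key 1 0 (by linear_combination -x1) (by linear_combination -x2)
    exact one_ne_zero this.1
  · intro hD a b hab
    by_contra! hall
    have e1 := hall (B.coord 0) (B.coord 1)
    have e2 := hall (B.coord 0) (B.coord 2)
    rw [hΛ, hΛ₁, ← hX₁, ← hX₂, ← hY₁, ← hY₂] at e1 e2
    simp only [B.coord_vec, Fin.isValue, if_true, Fin.reduceEq, if_false, mul_one, mul_zero,
      sub_zero, one_mul, zero_mul, add_zero, zero_add] at e1 e2
    have hD' : algebraMap 𝕜 ℂ X₁ * algebraMap 𝕜 ℂ Y₂ - algebraMap 𝕜 ℂ X₂ * algebraMap 𝕜 ℂ Y₁ ≠ 0 := by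
      rw [← map_mul, ← map_mul, ← map_sub]
      exact (map_ne_zero (algebraMap 𝕜 ℂ)).2 hD
    apply hab
    refine Prod.ext ?_ ?_
    · refine (mul_eq_zero.1 ?_).resolve_right hD'
      linear_combination algebraMap 𝕜 ℂ Y₂ * e1 - algebraMap 𝕜 ℂ Y₁ * e2
    · refine (mul_eq_zero.1 ?_).resolve_right hD'
      linear_combination algebraMap 𝕜 ℂ X₁ * e2 - algebraMap 𝕜 ℂ X₂ * e1

end NormalForm

/-! ### Bases adapted to the unimodular ideal. -/

section NormalForm

variable {𝕜 A : Type*} [RCLike 𝕜] [NormedAddCommGroup A] [NormedSpace 𝕜 A]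

/-- A basis of a hyperplane `J` and a vector outside `J` form a basis. -/
theorem exists_basis_adapted [FiniteDimensional 𝕜 A] (hA : Module.finrank 𝕜 A = 3) {J : Submodule 𝕜 A}
    (hJ : Module.finrank 𝕜 J = 2) {u : A} (hu : u ∉ J) :
    ∃ (b : Module.Basis (Fin 3) 𝕜 A) (e : Module.Basis (Fin 2) 𝕜 J),
      b 0 = u ∧ b 1 = e 0 ∧ b 2 = e 1 := by
  let e : Module.Basis (Fin 2) 𝕜 J := Module.finBasisOfFinrankEq 𝕜 J hJ
  have hli : LinearIndependent 𝕜 (Fin.cons u (fun i => (e i : A)) : Fin 3 → A) := by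
    refine LinearIndependent.finCons ?_ ?_
    · exact e.linearIndependent.map' J.subtype J.ker_subtype
    · intro h
      apply hu
      refine Submodule.span_le.2 ?_ h
      rintro _ ⟨i, rfl⟩
      exact (e i).2
  refine ⟨basisOfLinearIndependentOfCardEqFinrank hli (by simp [hA]), e, ?_, ?_, ?_⟩ <;>
    simp [coe_basisOfLinearIndependentOfCardEqFinrank]
  all_goals rfl

theorem trace_eq_sum_coord (b : Module.Basis (Fin 3) 𝕜 A) (T : Module.End 𝕜 A) :
    LinearMap.trace 𝕜 A T = b.repr (T (b 0)) 0 + b.repr (T (b 1)) 1 + b.repr (T (b 2)) 2 := by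
  rw [LinearMap.trace_eq_matrix_trace 𝕜 b, Matrix.trace_fin_three]
  simp [LinearMap.toMatrix_apply]

theorem repr_zero_of_mem {J : Submodule 𝕜 A} {b : Module.Basis (Fin 3) 𝕜 A}
    {e : Module.Basis (Fin 2) 𝕜 J} (h1 : b 1 = e 0) (h2 : b 2 = e 1) {x : A} (hx : x ∈ J) :
    b.repr x 0 = 0 ∧ x = b.repr x 1 • b 1 + b.repr x 2 • b 2 := by
  have h := congrArg (Subtype.val) (e.sum_repr ⟨x, hx⟩)
  simp only [Fin.sum_univ_two, Submodule.coe_add, Submodule.coe_smul, ← h1, ← h2] at h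
  have h0 : b.repr x 0 = 0 := by
    rw [← h]
    simp
  refine ⟨h0, ?_⟩
  have hs := b.sum_repr x
  rw [Fin.sum_univ_three, h0, zero_smul, zero_add] at hs
  exact hs.symm

/-- The unimodular ideal of a non-unimodular three-dimensional Lie algebra is abelian. -/
theorem LieBracket.ad_eq_zero_of_basis (L : LieBracket 𝕜 A) {b : Module.Basis (Fin 3) 𝕜 A}
    {e : Module.Basis (Fin 2) 𝕜 L.unimodularIdeal} (h1 : b 1 = e 0) (h2 : b 2 = e 1) :
    L.ad (b 1) (b 2) = 0 := by
  have m1 : b 1 ∈ L.unimodularIdeal := h1 ▸ (e 0).2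
  have m2 : b 2 ∈ L.unimodularIdeal := h2 ▸ (e 1).2
  have hid := L.isIdeal_unimodularIdeal
  have t1 : LinearMap.trace 𝕜 A (L.ad (b 1)) = 0 := m1
  have t2 : LinearMap.trace 𝕜 A (L.ad (b 2)) = 0 := m2
  have r1 := (repr_zero_of_mem h1 h2 (hid (b 0) _ m1)).1
  have r2 := (repr_zero_of_mem h1 h2 (hid (b 0) _ m2)).1
  -- As [b₀, I] ⊆ I, the traces of [b₁, ·] and [b₂, ·] are, up to sign, the b₂- and b₁-coefficients
  -- of [b₁, b₂].
  rw [trace_eq_sum_coord b, L.skew (b 1) (b 0), L.self_eq_zero] at t1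
  rw [trace_eq_sum_coord b, L.skew (b 2) (b 0), L.self_eq_zero, L.skew (b 2) (b 1)] at t2
  simp only [map_neg, Finsupp.neg_apply, r1, r2, map_zero, Finsupp.zero_apply] at t1 t2
  rw [(repr_zero_of_mem h1 h2 (hid (b 1) _ m2)).2,
    show b.repr (L.ad (b 1) (b 2)) 1 = 0 by linear_combination -t2,
    show b.repr (L.ad (b 1) (b 2)) 2 = 0 by linear_combination t1]
  simp

/-- The matrix of `[b₀, ·]` on an ideal spanned by `b₁`, `b₂`. -/
theorem LieBracket.exists_matrix (L : LieBracket 𝕜 A) {J : Submodule 𝕜 A} (hJ : L.IsIdeal J)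
    {b : Module.Basis (Fin 3) 𝕜 A} {e : Module.Basis (Fin 2) 𝕜 J} (h1 : b 1 = e 0)
    (h2 : b 2 = e 1) :
    ∃ α β γ δ : 𝕜, L.ad (b 0) (b 1) = α • b 1 + β • b 2 ∧
      L.ad (b 0) (b 2) = γ • b 1 + δ • b 2 ∧
      L.adRestrict hJ (b 0) (e 0) = α • e 0 + β • e 1 ∧
      L.adRestrict hJ (b 0) (e 1) = γ • e 0 + δ • e 1 ∧
      LinearMap.trace 𝕜 A (L.ad (b 0)) = α + δ := by
  have e1 := (repr_zero_of_mem h1 h2 (hJ (b 0) _ (h1 ▸ (e 0).2))).2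
  have e2 := (repr_zero_of_mem h1 h2 (hJ (b 0) _ (h2 ▸ (e 1).2))).2
  refine ⟨_, _, _, _, e1, e2, ?_, ?_, ?_⟩
  · apply Subtype.ext
    simpa [LieBracket.adRestrict, ← h1, ← h2] using e1
  · apply Subtype.ext
    simpa [LieBracket.adRestrict, ← h1, ← h2] using e2
  · rw [trace_eq_sum_coord b, L.self_eq_zero]
    simp

theorem LieBracket.ad_eq_zero (L : LieBracket 𝕜 A) {b : Module.Basis (Fin 3) 𝕜 A}
    (h1 : L.ad (b 0) (b 1) = 0) (h2 : L.ad (b 0) (b 2) = 0) (h12 : L.ad (b 1) (b 2) = 0) :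
    L.ad = 0 := by
  refine b.ext fun i => b.ext fun j => ?_
  fin_cases i <;> fin_cases j <;>
    simp [L.self_eq_zero, h1, h2, h12, L.skew (b 1) (b 0), L.skew (b 2) (b 0), L.skew (b 2) (b 1)]

end NormalForm

/-! ### The equivalence. -/

theorem proposition9 {𝕜 A : Type*} [RCLike 𝕜] [Algebra 𝕜 ℂ] [IsScalarTower ℝ 𝕜 ℂ]
    [NormedAddCommGroup A] [NormedSpace 𝕜 A] [FiniteDimensional 𝕜 A]
    (hA : Module.finrank 𝕜 A = 3)
    (L L₁ : LieBracket 𝕜 A)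
    (hL : ¬ L.IsUnimodular)
    (hL₁ : L₁.IsUnimodular) (hL₁0 : L₁.ad ≠ 0)
    (hI : L₁.IsIdeal L.unimodularIdeal) (hIab : L₁.IsAbelianOn L.unimodularIdeal)
    (u : A) (hu : u ∉ L.unimodularIdeal) :
    (IsGenericPair (liePoisson L) (liePoisson L₁) ∧
        ¬ IsFlatPair (liePoisson L) (liePoisson L₁)) ↔
      ∃ v : ℂ ⊗[𝕜] L.unimodularIdeal,
        IsComplexEigenvector (L₁.adRestrict hI u) v ∧
        ¬ IsComplexEigenvector (L.adRestrict L.isIdeal_unimodularIdeal u) v := by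
  have hdim : Module.finrank 𝕜 L.unimodularIdeal = 2 := by
    have hne : (LinearMap.trace 𝕜 A ∘ₗ L.ad : Module.Dual 𝕜 A) ≠ 0 := fun h =>
      hL fun a => LinearMap.congr_fun h a
    have := Module.Dual.finrank_ker_add_one_of_ne_zero hne
    rw [hA] at this
    exact Nat.succ_injective this
  obtain ⟨b, e, rfl, h1, h2⟩ := exists_basis_adapted hA hdim hu
  have hE : Module.finrank 𝕜 (StrongDual 𝕜 A) = 3 := by
    rw [← hA, ← Subspace.dual_finrank_eq (K := 𝕜) (V := A)]
    exact (LinearMap.toContinuousLinearMap (𝕜 := 𝕜) (E := A) (F' := 𝕜)).finrank_eq.symm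
  obtain ⟨α, β, γ, δ, f1, f2, f3, f4, f5⟩ := L.exists_matrix L.isIdeal_unimodularIdeal h1 h2
  obtain ⟨p, r, s, p', g1, g2, g3, g4, g5⟩ := L₁.exists_matrix hI h1 h2
  have f12 := L.ad_eq_zero_of_basis h1 h2
  have g12 : L₁.ad (b 1) (b 2) = 0 := hIab _ (h1 ▸ (e 0).2) _ (h2 ▸ (e 1).2)
  have hτ : α + δ ≠ 0 := fun h => hu (f5.trans h)
  obtain rfl : p' = -p := by
    rw [hL₁] at g5
    linear_combination -g5
  have h0 : p ≠ 0 ∨ r ≠ 0 ∨ s ≠ 0 := by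
    by_contra! h
    obtain ⟨rfl, rfl, rfl⟩ := h
    exact hL₁0 (L₁.ad_eq_zero (b := b) (by simp [g1]) (by simp [g2]) g12)
  set B := LinearFrame.ofBasis b
  have hΛ : IsWedgeLinear B (liePoisson L) α β γ δ := isWedgeLinear_liePoisson L b f1 f2 f12
  have hΛ₁ : IsWedgeLinear B (liePoisson L₁) p r s (-p) :=
    isWedgeLinear_liePoisson L₁ b g1 g2 g12
  set σ := algebraMap 𝕜 ℂ
  have hσ2 : σ 2 = 2 := map_ofNat σ 2
  -- The parallelism identities hold over 𝕜, whereas the eigenvectors are complex, so the identities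
  -- are transported along `σ`.
  have hcommon : p * (γ * p + δ * s - s * α + p * γ) - s * (β * s - r * γ) = 0 →
      p * (γ * r - δ * p - s * β + p * δ) + r * (γ * p + δ * s - s * α + p * γ)
        - s * (α * r - 2 * (p * β) - r * δ) + p * (β * s - r * γ) = 0 →
      r * (γ * r - s * β) + p * (α * r - 2 * (p * β) - r * δ) = 0 →
      ∀ v, IsComplexEigenvector (L₁.adRestrict hI (b 0)) v →
        IsComplexEigenvector (L.adRestrict L.isIdeal_unimodularIdeal (b 0)) v := by
    intro n0 n1 n2 v hv
    obtain ⟨v₁, v₂, rfl⟩ := exists_tmul_add_tmul_eq e v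
    rw [isComplexEigenvector_iff e g3 g4] at hv
    rw [isComplexEigenvector_iff e f3 f4]
    refine ⟨hv.1, ?_⟩
    have hS := hv.2
    rw [map_neg] at hS
    refine common_zeros_of_commutator_parallel (p := σ p) (r := σ r) (s := σ s) ?_ ?_ ?_ ?_ hS
    · simpa [map_eq_zero] using h0
    · simpa using congrArg σ n0
    · simpa [hσ2] using congrArg σ n1
    · simpa [hσ2] using congrArg σ n2
  constructor
  · rintro ⟨-, hnf⟩
    by_contra! hall
    apply hnf
    -- Eigenvectors exist only over ℂ, but the resulting minors have entries in 𝕜 and descend by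
    -- injectivity of `σ`, so the factor k lies in 𝕜.
    obtain ⟨m1, m2, m3⟩ := minors_eq_zero_of_common_zeros (K := ℂ) (α := σ α) (β := σ β) (γ := σ γ)
      (δ := σ δ) (p := σ p) (r := σ r) (s := σ s) (fun v₁ v₂ hv hS => by
        have := hall (v₁ ⊗ₜ[𝕜] e 0 + v₂ ⊗ₜ[𝕜] e 1)
          ((isComplexEigenvector_iff e g3 g4 v₁ v₂).2 ⟨hv, by rw [map_neg]; exact hS⟩)
        exact ((isComplexEigenvector_iff e f3 f4 v₁ v₂).1 this).2)
    obtain ⟨k, hk⟩ := exists_proportional_of_minors h0 (α := α) (β := β) (γ := γ) (δ := δ)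
      (σ.injective (by simpa [hσ2] using m1)) (σ.injective (by simpa using m2))
      (σ.injective (by simpa [hσ2] using m3))
    intro q hq
    rw [isGenericAt_iff B hΛ hΛ₁] at hq
    exact isFlatAt_of_proportional hE B hΛ hΛ₁ hk hq
  · rintro ⟨v, hv, hv'⟩
    -- If X ∧ Y vanished identically, [X, Y] would be parallel to Y as well: its coefficients are
    -- combinations of those of X ∧ Y, and `hcommon` would contradict the choice of v.
    have hgen : IsGenericPair (liePoisson L) (liePoisson L₁) := by
      by_contra hng
      have hD : ∀ q ∈ (Set.univ : Set (StrongDual 𝕜 A)),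
          (α * s - γ * p) * B.coord 1 q ^ 2 +
          (β * s - α * p - γ * r - δ * p) * (B.coord 1 q * B.coord 2 q) +
          (-(β * p + δ * r)) * B.coord 2 q ^ 2 = 0 := by
        intro q _
        have := mt (isGenericAt_iff B hΛ hΛ₁ q).2 fun h => hng ⟨q, h⟩
        rw [not_not] at this
        linear_combination this
      obtain ⟨d0, d1, d2⟩ := quadratic_eq_zero_of_open B isOpen_univ (Set.mem_univ 0) hD
      refine hv' (hcommon ?_ ?_ ?_ v hv)
      · linear_combination -s * d1 - 2 * p * d0
      · linear_combination -2 * r * d0 - 2 * s * d2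
      · linear_combination -r * d1 + 2 * p * d2
    refine ⟨hgen, fun hflat => ?_⟩
    obtain ⟨q, hq⟩ := hgen
    obtain ⟨n0, n1, n2⟩ := (hflat q hq).commutator_parallel B hτ hΛ hΛ₁
    exact hv' (hcommon n0 n1 n2 v hv)
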